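/- Let $A(n)=\sum_{p^\nu\,\|\,n}\nu p$ and $A^*(n)=\sum_{p\mid n}p$ be the Alladi–Erdős functions, and let $B(n)=A(n)-A^*(n)$ for every positive integer $n$. Let $\gamma$ be Euler's constant, and let sums over $p$ run over the primes. Let $k\ge 2$ be a fixed integer. Then, as $x\to\infty$ through the real numbers, $$\sum_{n_1,\dots,n_k\le x} B([n_1,\dots,n_k]) = k\,x^k\log\log\sqrt{x} + H_k x^k + O\!\left(\frac{x^k}{\log x}\right),$$ where the sum is over all $k$-tuples of positive integers not exceeding $x$, $[n_1,\dots,n_k]$ is the least common multiple, the implied constant depends only on $k$, $$H_k = kF+\sum_{j=2}^{k}(-1)^{j-1}\binom{k}{j}\sum_p\frac{1}{p^{j-1}(p^j-1)},\qquad F=\gamma+\sum_p\left(\log\left(1-\frac1p\right)+\frac1{p-1}\right),$$ and all the series over primes in these constants converge absolutely. -/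

import Mathlib

open Filter Asymptotics

/-- The Alladi–Erdős function `A(n) = ∑_{p^ν ∥ n} ν p`. -/
def alladiErdosA (n : ℕ) : ℕ := ∑ p ∈ n.primeFactors, n.factorization p * p

/-- The Alladi–Erdős function `A*(n) = ∑_{p ∣ n} p`. -/
def alladiErdosAStar (n : ℕ) : ℕ := ∑ p ∈ n.primeFactors, p

/-- `B(n) = A(n) - A*(n)`, with the subtraction taken in the reals. -/
noncomputable def alladiErdosB (n : ℕ) : ℝ := (alladiErdosA n : ℝ) - (alladiErdosAStar n : ℝ)

/-- The term at the prime `p` of the series in the constant `F`. -/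
noncomputable def termF (p : Nat.Primes) : ℝ :=
  Real.log (1 - 1 / (p : ℝ)) + 1 / ((p : ℝ) - 1)

/-- `F = γ + ∑_p (log (1 - 1/p) + 1/(p - 1))`, where `γ` is Euler's constant. -/
noncomputable def constF : ℝ := Real.eulerMascheroniConstant + ∑' p : Nat.Primes, termF p

/-- The term `1 / (p^(j-1) (p^j - 1))` at the prime `p` (used for `j ≥ 2`). -/
noncomputable def termH (j : ℕ) (p : Nat.Primes) : ℝ :=
  1 / ((p : ℝ) ^ (j - 1) * ((p : ℝ) ^ j - 1))

/-- `H_k = k F + ∑_{j=2}^k (-1)^(j-1) C(k,j) ∑_p 1 / (p^(j-1) (p^j - 1))`. -/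
noncomputable def constH (k : ℕ) : ℝ :=
  k * constF + ∑ j ∈ Finset.Icc 2 k, (-1 : ℝ) ^ (j - 1) * (k.choose j : ℝ) * ∑' p, termH j p

/-- `∑_{n_1, …, n_k ≤ x} B([n_1, …, n_k])`, over all `k`-tuples of positive integers
that are at most `x`. -/
noncomputable def sumBLcm (k : ℕ) (x : ℝ) : ℝ :=
  ∑ n ∈ Fintype.piFinset (fun _ : Fin k => Finset.Icc 1 ⌊x⌋₊),
    alladiErdosB (Finset.univ.lcm n)

/-! `B m` counts each prime `p` once for every exponent `b ≥ 2` with `p ^ b ∣ m`, and `p ^ b`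
divides an lcm exactly when it divides one of the entries. With `N = ⌊x⌋₊`, counting the complement
gives the exact formula `sumBLcm_eq`: the sum over `p ≤ √N` and `b ≥ 2` of `p (N^k - (N -
⌊N/p^b⌋)^k)`. Dropping the floors and summing geometric series in `b` turns the contribution of `p`
into `N^k ∑_j (-1)^(j-1) C(k,j) / (p^(j-1) (p^j - 1))`. The error per prime is at most `k N^(k-1) p
(log_p N + 1) ≪ N^(k-1) √N`, and Chebyshev's bound for `π(√N)` makes the total `O(N^k / log N)`
(`eventually_abs_sumBLcm_sub_le`).

For `j ≥ 2` the prime series converge with tails `O(1 / log N)`. The term `j = 1` is `k ∑ 1/(p-1)`,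
which Mertens' second theorem evaluates as `k (log log √N + F) + O(1 / log N)`. That theorem follows
by partial summation from the factorization of `n!`. Its constant (`mertens_constant_eq`) comes from
an Abelian theorem: the limit of `∑_{p ≤ e^u} 1/p - ∑_{n ≤ u} 1/n` as `u → ∞` equals that of `∑_p
p^(-1-σ) + log (1 - e^(-σ))` as `σ → 0+`, which the Euler product and the simple pole of `ζ` at 1
compute. -/

/-! ### Mertens' first theorem -/

/-- Weak Stirling bounds for `log n!`. -/
lemma log_factorial_bounds {n : ℕ} (hn : 1 ≤ n) :
    n * Real.log n - n ≤ Real.log (n.factorial) ∧ Real.log (n.factorial) ≤ n * Real.log n := by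
  have hn' : (0 : ℝ) < n := by exact_mod_cast hn
  have hf : (0 : ℝ) < n.factorial := by exact_mod_cast n.factorial_pos
  constructor
  · have h := Real.pow_div_factorial_le_exp (x := n) hn'.le n
    have h2 := Real.log_le_log (by positivity) h
    rw [Real.log_exp, Real.log_div (by positivity) hf.ne', Real.log_pow] at h2
    linarith
  · have h : (n.factorial : ℝ) ≤ (n : ℝ) ^ n := by exact_mod_cast n.factorial_le_pow
    have h2 := Real.log_le_log hf h
    rwa [Real.log_pow] at h2

lemma log_factorial_eq_sum_primesLE (n : ℕ) :
    Real.log (n.factorial) =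
      ∑ p ∈ Nat.primesLE n, (n.factorial.factorization p : ℝ) * Real.log p := by
  rw [Real.log_nat_eq_sum_factorization, Finsupp.sum]
  refine Finset.sum_subset ?_ ?_
  · intro p hp
    rw [Nat.support_factorization, Nat.mem_primeFactors] at hp
    exact Nat.mem_primesLE.2 ⟨(hp.1.dvd_factorial).1 hp.2.1, hp.1⟩
  · intro p _ hp
    rw [Finsupp.notMem_support_iff] at hp
    simp [hp]

/-- Both bounds are Legendre's formula: its first term gives the lower one, its digit-sum form the
upper one. -/
lemma factorization_factorial_bounds {n p : ℕ} (hp : p.Prime) :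
    (n : ℝ) / p - 1 ≤ n.factorial.factorization p ∧
      (n.factorial.factorization p : ℝ) ≤ n / ((p : ℝ) - 1) := by
  have h1 : (1 : ℝ) < p := by exact_mod_cast hp.one_lt
  constructor
  · have h : n / p ≤ n.factorial.factorization p := by
      rw [Nat.factorization_factorial hp (b := Nat.log p n + 2) (by omega)]
      refine le_trans (by simp) (Finset.single_le_sum (f := fun i => n / p ^ i)
        (fun _ _ => Nat.zero_le _) (a := 1) (by simp))
    have h2 : (n : ℝ) / p < (n / p : ℕ) + 1 := by
      have := Nat.lt_floor_add_one ((n : ℝ) / p)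
      rwa [Nat.floor_div_natCast, Nat.floor_natCast] at this
    have h3 : ((n / p : ℕ) : ℝ) ≤ n.factorial.factorization p := by exact_mod_cast h
    linarith
  · have h := Nat.sub_one_mul_factorization_factorial hp (n := n)
    have h2 : (p - 1) * n.factorial.factorization p ≤ n := by omega
    rw [le_div_iff₀ (by linarith)]
    have h3 : (((p - 1) * n.factorial.factorization p : ℕ) : ℝ) ≤ n := by exact_mod_cast h2
    push_cast [Nat.cast_sub hp.one_le] at h3
    linarith

/-- Controls the excess of `1/(p-1)` over `1/p` in the Legendre upper bound; `log p ≤ 2 √p` gives a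
majorant `4 n^(-3/2)`. -/
lemma exists_sum_log_div_mul_sub_one_le :
    ∃ K : ℝ, ∀ n : ℕ, ∑ p ∈ Nat.primesLE n, Real.log p / (p * ((p : ℝ) - 1)) ≤ K := by
  have hs : Summable (fun n : ℕ => 4 * (1 / (n : ℝ) ^ (3 / 2 : ℝ))) :=
    (Real.summable_one_div_nat_rpow.2 (by norm_num)).mul_left _
  refine ⟨∑' n : ℕ, 4 * (1 / (n : ℝ) ^ (3 / 2 : ℝ)), fun n => ?_⟩
  refine le_trans (Finset.sum_le_sum fun p hp => ?_)
    (hs.sum_le_tsum (Nat.primesLE n) fun i _ => by positivity)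
  have hp2 : (2 : ℝ) ≤ p := by exact_mod_cast Nat.two_le_of_mem_primesLE hp
  have hlog : Real.log p ≤ 2 * (p : ℝ) ^ (1 / 2 : ℝ) := by
    have := Real.log_le_rpow_div (x := p) (by positivity) (ε := 1 / 2) (by norm_num)
    linarith
  have hpow : (p : ℝ) ^ (1 / 2 : ℝ) * (p : ℝ) ^ (3 / 2 : ℝ) = p ^ 2 := by
    rw [← Real.rpow_add (by positivity)]
    norm_num
  have h0 : (0 : ℝ) < (p : ℝ) ^ (3 / 2 : ℝ) := by positivity
  rw [mul_one_div, div_le_div_iff₀ (by nlinarith) h0]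
  calc Real.log p * (p : ℝ) ^ (3 / 2 : ℝ)
      ≤ 2 * (p : ℝ) ^ (1 / 2 : ℝ) * (p : ℝ) ^ (3 / 2 : ℝ) := by gcongr
    _ = 2 * p ^ 2 := by rw [mul_assoc, hpow]
    _ ≤ 4 * (p * ((p : ℝ) - 1)) := by nlinarith

/-- Mertens' first theorem. -/
lemma exists_abs_sum_log_div_sub_log_le :
    ∃ K : ℝ, ∀ n : ℕ, 1 ≤ n →
      |∑ p ∈ Nat.primesLE n, Real.log p / p - Real.log n| ≤ K := by
  obtain ⟨K, hK⟩ := exists_sum_log_div_mul_sub_one_le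
  -- `log 4` comes from Chebyshev's `θ(n) ≤ n log 4`, which absorbs the `-1` lost at each prime; `1
  -- + K` comes from the `-n` in Stirling and the convergent series.
  refine ⟨max (Real.log 4) (1 + K), fun n hn => ?_⟩
  have hn' : (0 : ℝ) < n := by exact_mod_cast hn
  obtain ⟨hl, hu⟩ := log_factorial_bounds hn
  rw [log_factorial_eq_sum_primesLE] at hl hu
  have hθ := Chebyshev.theta_le_log4_mul_x hn'.le
  rw [Chebyshev.theta_eq_sum_primesLE_log] at hθ
  have h1 : (n : ℝ) * ∑ p ∈ Nat.primesLE n, Real.log p / p ≤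
      ∑ p ∈ Nat.primesLE n, (n.factorial.factorization p : ℝ) * Real.log p +
        ∑ p ∈ Nat.primesLE n, Real.log p := by
    rw [Finset.mul_sum, ← Finset.sum_add_distrib]
    refine Finset.sum_le_sum fun p hp => ?_
    have hp' := Nat.prime_of_mem_primesLE hp
    have := mul_le_mul_of_nonneg_right (factorization_factorial_bounds (n := n) hp').1
      (Real.log_natCast_nonneg p)
    calc (n : ℝ) * (Real.log p / p) = (n / p - 1) * Real.log p + Real.log p := by ring
      _ ≤ _ := by linarith
  have h2 : ∑ p ∈ Nat.primesLE n, (n.factorial.factorization p : ℝ) * Real.log p ≤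
      n * ∑ p ∈ Nat.primesLE n, Real.log p / p +
        n * ∑ p ∈ Nat.primesLE n, Real.log p / (p * ((p : ℝ) - 1)) := by
    rw [Finset.mul_sum, Finset.mul_sum, ← Finset.sum_add_distrib]
    refine Finset.sum_le_sum fun p hp => ?_
    have hp' := Nat.prime_of_mem_primesLE hp
    have hp1 : (1 : ℝ) < p := by exact_mod_cast hp'.one_lt
    have hp3 : (p : ℝ) - 1 ≠ 0 := by linarith
    have := mul_le_mul_of_nonneg_right (factorization_factorial_bounds (n := n) hp').2
      (Real.log_natCast_nonneg p)
    refine this.trans (le_of_eq ?_)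
    field_simp
    ring
  have h3 := mul_le_mul_of_nonneg_left (hK n) hn'.le
  rw [abs_le]
  constructor
  · have : (n : ℝ) * (Real.log n - 1 - K) ≤ n * ∑ p ∈ Nat.primesLE n, Real.log p / p := by
      nlinarith
    have := le_of_mul_le_mul_left this hn'
    linarith [le_max_right (Real.log 4) (1 + K)]
  · have : (n : ℝ) * ∑ p ∈ Nat.primesLE n, Real.log p / p ≤ n * (Real.log n + Real.log 4) := by
      nlinarith
    have := le_of_mul_le_mul_left this hn'
    linarith [le_max_left (Real.log 4) (1 + K)]

/-! ### Mertens' second theorem by partial summation -/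

lemma sum_primesLE_succ (f : ℕ → ℝ) (n : ℕ) :
    ∑ p ∈ Nat.primesLE (n + 1), f p =
      ∑ p ∈ Nat.primesLE n, f p + if (n + 1).Prime then f (n + 1) else 0 := by
  rw [Nat.primesLE_succ]
  split_ifs with h
  · rw [Finset.sum_insert (Nat.notMem_primesLE n)]
    ring
  · simp

lemma log_succ_sub_log_le {n : ℕ} (hn : 1 ≤ n) :
    Real.log (n + 1 : ℕ) - Real.log n ≤ 1 / n := by
  have hn' : (0 : ℝ) < n := by exact_mod_cast hn
  rw [← Real.log_div (by positivity) hn'.ne']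
  refine (Real.log_le_sub_one_of_pos (by positivity)).trans (le_of_eq ?_)
  push_cast
  field_simp
  ring

/-- Both quantities lie between `(u-v)/u` and `(u-v)/v`, whose gap is `(u-v)(1/v - 1/u)`. With `u =
log (n+1)` and `v = log n` the bound telescopes. -/
lemma abs_log_sub_log_sub_le {u v : ℝ} (hv : 0 < v) (huv : v ≤ u) (h1 : u - v ≤ 1) :
    |(u - v) / u - (Real.log u - Real.log v)| ≤ 1 / v - 1 / u := by
  have hu : 0 < u := hv.trans_le huv
  have e1 : Real.log u - Real.log v ≤ (u - v) / v := by
    rw [← Real.log_div hu.ne' hv.ne']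
    refine (Real.log_le_sub_one_of_pos (by positivity)).trans (le_of_eq ?_)
    field_simp
  have e2 : (u - v) / u ≤ Real.log u - Real.log v := by
    have := Real.log_le_sub_one_of_pos (x := v / u) (by positivity)
    rw [Real.log_div hv.ne' hu.ne'] at this
    have e : (u - v) / u = -(v / u - 1) := by field_simp; ring
    linarith
  have e3 : (u - v) / v - (u - v) / u ≤ 1 / v - 1 / u := by
    have : (u - v) / v - (u - v) / u = (u - v) * (1 / v - 1 / u) := by field_simp
    rw [this]
    have h4 : 1 / u ≤ 1 / v := one_div_le_one_div_of_le hv huv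
    nlinarith
  rw [abs_le]
  constructor <;> linarith

/-- A sequence whose increments are dominated by those of `-K / log n` converges at rate
`K / log n`. -/
lemma exists_abs_sub_le_div_log {D : ℕ → ℝ} {K : ℝ}
    (hD : ∀ n : ℕ, 2 ≤ n →
      |D (n + 1) - D n| ≤ K * (1 / Real.log n - 1 / Real.log (n + 1 : ℕ))) :
    ∃ C : ℝ, ∀ n : ℕ, 2 ≤ n → |D n - C| ≤ K / Real.log n := by
  have hlog : ∀ n : ℕ, 2 ≤ n → 0 < Real.log n := fun n hn =>
    Real.log_pos (by exact_mod_cast hn)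
  have hK : 0 ≤ K := by
    have h := (abs_nonneg _).trans (hD 2 le_rfl)
    have h2 : (0 : ℝ) < 1 / Real.log (2 : ℕ) - 1 / Real.log (2 + 1 : ℕ) :=
      sub_pos.2 (one_div_lt_one_div_of_lt (hlog 2 le_rfl)
        (Real.log_lt_log (by norm_num) (by norm_num)))
    exact nonneg_of_mul_nonneg_left h h2
  have key : ∀ m : ℕ, 2 ≤ m → ∀ j : ℕ,
      |D (m + j) - D m| ≤ K * (1 / Real.log m - 1 / Real.log (m + j : ℕ)) := by
    intro m hm j
    induction j with
    | zero => simp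
    | succ j ih =>
      have h := hD (m + j) (by omega)
      have h2 := abs_sub_le (D (m + j + 1)) (D (m + j)) (D m)
      rw [← add_assoc]
      linarith
  have key2 : ∀ m : ℕ, 2 ≤ m → ∀ n : ℕ, m ≤ n → |D n - D m| ≤ K / Real.log m := by
    intro m hm n hmn
    obtain ⟨j, rfl⟩ := Nat.exists_eq_add_of_le hmn
    refine (key m hm j).trans ?_
    have := hlog (m + j) (by omega)
    rw [div_eq_mul_one_div K]
    refine mul_le_mul_of_nonneg_left ?_ hK
    have : 0 < 1 / Real.log (m + j : ℕ) := by positivity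
    linarith
  have hcau : CauchySeq D := by
    refine Metric.cauchySeq_iff'.2 fun ε hε => ?_
    have ht : Tendsto (fun n : ℕ => K / Real.log n) atTop (nhds 0) :=
      (Real.tendsto_log_atTop.comp tendsto_natCast_atTop_atTop).const_div_atTop K
    obtain ⟨N, hN2, hN⟩ := ((eventually_ge_atTop 2).and (ht.eventually_lt_const hε)).exists
    exact ⟨N, fun n hn => (key2 N hN2 n hn).trans_lt hN⟩
  obtain ⟨C, hC⟩ := cauchySeq_tendsto_of_complete hcau
  refine ⟨C, fun m hm => ?_⟩
  have h := (hC.sub_const (D m)).abs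
  rw [abs_sub_comm]
  exact le_of_tendsto h (eventually_atTop.2 ⟨m, fun n hn => key2 m hm n hn⟩)

/-- Mertens' second theorem, with an unspecified constant. -/
lemma exists_abs_sum_inv_primes_sub_le :
    ∃ C K : ℝ, ∀ n : ℕ, 2 ≤ n →
      |∑ p ∈ Nat.primesLE n, 1 / (p : ℝ) - Real.log (Real.log n) - C| ≤ K / Real.log n := by
  obtain ⟨K, hK⟩ := exists_abs_sum_log_div_sub_log_le
  set S : ℕ → ℝ := fun n => ∑ p ∈ Nat.primesLE n, Real.log p / p with hS
  set E : ℕ → ℝ := fun n => ∑ p ∈ Nat.primesLE n, 1 / (p : ℝ) with hE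
  have hlog : ∀ n : ℕ, 2 ≤ n → 0 < Real.log n := fun n hn =>
    Real.log_pos (by exact_mod_cast hn)
  -- The subtracted quotient is the boundary term of partial summation; without it the increments of
  -- `D` would not be dominated by those of `-1 / log n`.
  obtain ⟨C, hC⟩ := exists_abs_sub_le_div_log (K := 1 + K)
    (D := fun n => E n - Real.log (Real.log n) - (S n - Real.log n) / Real.log n) (by
      intro n hn
      have hv := hlog n hn
      have huv : Real.log n ≤ Real.log (n + 1 : ℕ) :=
        Real.log_le_log (by positivity) (by push_cast; linarith)
      have hu := hv.trans_le huv
      have h1 : Real.log (n + 1 : ℕ) - Real.log n ≤ 1 :=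
        (log_succ_sub_log_le (by omega)).trans
          (div_le_one_of_le₀ (by exact_mod_cast (by omega : 1 ≤ n)) (by positivity))
      have hA := abs_log_sub_log_sub_le hv huv h1
      have hr := hK n (by omega)
      have hinc : E (n + 1) = E n + (S (n + 1) - S n) / Real.log (n + 1 : ℕ) := by
        simp only [hE, hS, sum_primesLE_succ]
        split_ifs with hp
        · field_simp
          ring
        · simp
      have hB : |(S n - Real.log n) * (1 / Real.log n - 1 / Real.log (n + 1 : ℕ))| ≤
          K * (1 / Real.log n - 1 / Real.log (n + 1 : ℕ)) := by
        have h4 : 0 ≤ 1 / Real.log n - 1 / Real.log (n + 1 : ℕ) :=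
          sub_nonneg.2 (one_div_le_one_div_of_le hv huv)
        rw [abs_mul, abs_of_nonneg h4]
        exact mul_le_mul_of_nonneg_right hr h4
      have hid : (E (n + 1) - Real.log (Real.log (n + 1 : ℕ)) -
            (S (n + 1) - Real.log (n + 1 : ℕ)) / Real.log (n + 1 : ℕ)) -
          (E n - Real.log (Real.log n) - (S n - Real.log n) / Real.log n) =
          ((Real.log (n + 1 : ℕ) - Real.log n) / Real.log (n + 1 : ℕ) -
            (Real.log (Real.log (n + 1 : ℕ)) - Real.log (Real.log n))) +
          (S n - Real.log n) * (1 / Real.log n - 1 / Real.log (n + 1 : ℕ)) := by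
        rw [hinc]
        field_simp
        ring
      rw [hid, add_mul, one_mul]
      exact (abs_add_le _ _).trans (add_le_add hA hB))
  refine ⟨C, 1 + 2 * K, fun n hn => ?_⟩
  have h1 := hC n hn
  have h2 : |(S n - Real.log n) / Real.log n| ≤ K / Real.log n := by
    rw [abs_div, abs_of_pos (hlog n hn)]
    exact div_le_div_of_nonneg_right (hK n (by omega)) (hlog n hn).le
  have h3 : E n - Real.log (Real.log n) - C =
      (E n - Real.log (Real.log n) - (S n - Real.log n) / Real.log n - C) +
        (S n - Real.log n) / Real.log n := by ring
  rw [h3]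
  refine (abs_add_le _ _).trans ((add_le_add h1 h2).trans (le_of_eq ?_))
  ring

/-! ### An Abelian theorem for Dirichlet series -/

lemma integral_exp_neg_ite {l : ℝ} (hl : 0 < l) (c : ℝ) :
    ∫ v in Set.Ioi (0 : ℝ), Real.exp (-v) * (if l ≤ v then c else 0) = c * Real.exp (-l) := by
  have h : (fun v : ℝ => Real.exp (-v) * (if l ≤ v then c else 0)) =
      (Set.Ici l).indicator (fun v => Real.exp (-v) * c) := by
    ext v
    simp [Set.indicator_apply]
  rw [h, MeasureTheory.setIntegral_indicator measurableSet_Ici,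
    Set.inter_eq_right.2 (Set.Ici_subset_Ioi.2 hl),
    MeasureTheory.integral_Ici_eq_integral_Ioi,
    MeasureTheory.integral_mul_const, integral_exp_neg_Ioi, mul_comm]

lemma integrableOn_exp_neg_ite (l c : ℝ) :
    MeasureTheory.IntegrableOn (fun v : ℝ => Real.exp (-v) * (if l ≤ v then c else 0))
      (Set.Ioi 0) := by
  have h : (fun v : ℝ => Real.exp (-v) * (if l ≤ v then c else 0)) =
      (Set.Ici l).indicator (fun v => Real.exp (-v) * c) := by
    ext v
    simp [Set.indicator_apply]
  rw [h]
  exact ((integrableOn_exp_neg_Ioi 0).mul_const c).indicator measurableSet_Ici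

/-- An Abelian theorem for general Dirichlet series `∑ c i * exp (-σ * l i)`: if the summatory
function `f` of the coefficients is bounded and tends to `L`, then the series tends to `L` as
`σ → 0+`. -/
lemma tendsto_tsum_mul_exp_neg {ι : Type*} [Countable ι] {c l : ι → ℝ} {f : ℝ → ℝ} {B L : ℝ}
    (hl : ∀ i, 0 < l i) (hf : Measurable f) (hB : ∀ u, |f u| ≤ B)
    (hL : Tendsto f atTop (nhds L))
    (hfs : ∀ u, HasSum (fun i => if l i ≤ u then c i else 0) (f u))
    (hs : ∀ σ : ℝ, 0 < σ → Summable (fun i => |c i| * Real.exp (-(σ * l i)))) :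
    Tendsto (fun σ : ℝ => ∑' i, c i * Real.exp (-(σ * l i))) (nhdsWithin 0 (Set.Ioi 0))
      (nhds L) := by
  -- Each `exp (-σ l)` is the integral of `exp (-v)` over `v ≥ σ l`; interchanging sum and integral
  -- leaves the summatory function at `v / σ`, ready for dominated convergence.
  have key : ∀ σ : ℝ, 0 < σ → ∑' i, c i * Real.exp (-(σ * l i)) =
      ∫ v in Set.Ioi (0 : ℝ), Real.exp (-v) * f (v / σ) := by
    intro σ hσ
    have hpos : ∀ i, 0 < σ * l i := fun i => mul_pos hσ (hl i)
    have h := MeasureTheory.hasSum_integral_of_summable_integral_norm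
      (μ := MeasureTheory.volume.restrict (Set.Ioi (0 : ℝ)))
      (F := fun i v => Real.exp (-v) * (if σ * l i ≤ v then c i else 0))
      (fun i => integrableOn_exp_neg_ite _ _) (by
        refine (hs σ hσ).congr fun i => ?_
        rw [← integral_exp_neg_ite (hpos i)]
        refine MeasureTheory.integral_congr_ae (Eventually.of_forall fun v => ?_)
        simp only [Real.norm_eq_abs, abs_mul, Real.abs_exp]
        split_ifs <;> simp)
    simp only [integral_exp_neg_ite (hpos _)] at h
    rw [h.tsum_eq]
    refine MeasureTheory.integral_congr_ae (Eventually.of_forall fun v => ?_)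
    simp only
    rw [tsum_mul_left, ← (hfs (v / σ)).tsum_eq]
    congr 1
    refine tsum_congr fun i => ?_
    simp only [le_div_iff₀ hσ, mul_comm]
  have hlim : Tendsto (fun σ : ℝ => ∫ v in Set.Ioi (0 : ℝ), Real.exp (-v) * f (v / σ))
      (nhdsWithin 0 (Set.Ioi 0)) (nhds (∫ v in Set.Ioi (0 : ℝ), Real.exp (-v) * L)) := by
    refine MeasureTheory.tendsto_integral_filter_of_dominated_convergence
      (fun v => Real.exp (-v) * B) (Eventually.of_forall fun σ => ?_)
      (Eventually.of_forall fun σ => Eventually.of_forall fun v => ?_)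
      ((integrableOn_exp_neg_Ioi 0).mul_const B) ?_
    · exact Measurable.aestronglyMeasurable
        ((Real.measurable_exp.comp measurable_neg).mul (hf.comp (measurable_id.div_const σ)))
    · rw [norm_mul, Real.norm_eq_abs, Real.norm_eq_abs, Real.abs_exp]
      exact mul_le_mul_of_nonneg_left (hB _) (Real.exp_pos _).le
    · refine (MeasureTheory.ae_restrict_iff' measurableSet_Ioi).2 (Eventually.of_forall ?_)
      intro v hv
      refine Tendsto.const_mul _ (hL.comp ?_)
      exact tendsto_inv_nhdsGT_zero.const_mul_atTop hv
  rw [MeasureTheory.integral_mul_const, integral_exp_neg_Ioi, neg_zero, Real.exp_zero,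
    one_mul] at hlim
  refine hlim.congr' ?_
  filter_upwards [self_mem_nhdsWithin] with σ hσ
  exact (key σ hσ).symm

/-! ### The Mertens constant from the pole of zeta -/

lemma hasSum_primes_ite_le (g : ℕ → ℝ) (m : ℕ) :
    HasSum (fun p : Nat.Primes => if (p : ℕ) ≤ m then g p else 0)
      (∑ p ∈ Nat.primesLE m, g p) := by
  have h : HasSum (fun n : ℕ => if n ∈ Nat.primesLE m then g n else 0)
      (∑ p ∈ Nat.primesLE m, g p) := by
    rw [← Finset.sum_congr rfl fun p hp => if_pos (c := p ∈ Nat.primesLE m) hp (e := 0)]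
    exact hasSum_sum_of_ne_finset_zero fun n hn => if_neg hn
  have hinj : Function.Injective (fun p : Nat.Primes => (p : ℕ)) := Nat.Primes.coe_nat_injective
  rw [← hinj.hasSum_iff] at h
  · refine h.congr_fun ?_
    intro p
    simp [Nat.mem_primesLE, p.2]
  · intro n hn
    refine if_neg fun hn' => hn ⟨⟨n, Nat.prime_of_mem_primesLE hn'⟩, rfl⟩

/-- `∑_{p ≤ e^u} 1/p - ∑_{n ≤ u} 1/n`. -/
noncomputable def primeHarmonicDiff (u : ℝ) : ℝ :=
  ∑ p ∈ Nat.primesLE ⌊Real.exp u⌋₊, 1 / (p : ℝ) - (harmonic ⌊u⌋₊ : ℝ)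

lemma measurable_primeHarmonicDiff : Measurable primeHarmonicDiff := by
  refine Measurable.sub ?_ ?_
  · exact (measurable_from_top (f := fun n : ℕ => ∑ p ∈ Nat.primesLE n, 1 / (p : ℝ))).comp
      (Nat.measurable_floor.comp Real.measurable_exp)
  · exact (measurable_from_top (f := fun n : ℕ => (harmonic n : ℝ))).comp Nat.measurable_floor

lemma harmonic_cast_eq (n : ℕ) :
    (harmonic n : ℝ) = ∑ i ∈ Finset.range n, 1 / ((i : ℝ) + 1) := by
  simp [harmonic]

lemma tendsto_log_floor_sub_log :
    Tendsto (fun x : ℝ => Real.log ⌊x⌋₊ - Real.log x) atTop (nhds 0) := by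
  have h := (Real.continuousAt_log one_ne_zero).tendsto.comp
    (tendsto_nat_floor_div_atTop (R := ℝ))
  rw [Real.log_one] at h
  refine h.congr' ?_
  filter_upwards [eventually_ge_atTop 1] with x hx
  have : (⌊x⌋₊ : ℝ) ≠ 0 := by
    exact_mod_cast (Nat.floor_pos.2 hx).ne'
  simp [Real.log_div this (by positivity : x ≠ 0)]

/-- At scale `e^u` both sums grow like `log u`: the prime sum with constant `C`, the harmonic sum
with constant `γ`. -/
lemma tendsto_primeHarmonicDiff {C K : ℝ}
    (hC : ∀ n : ℕ, 2 ≤ n →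
      |∑ p ∈ Nat.primesLE n, 1 / (p : ℝ) - Real.log (Real.log n) - C| ≤ K / Real.log n) :
    Tendsto primeHarmonicDiff atTop (nhds (C - Real.eulerMascheroniConstant)) := by
  have h1 : Tendsto (fun n : ℕ => ∑ p ∈ Nat.primesLE n, 1 / (p : ℝ) - Real.log (Real.log n))
      atTop (nhds C) := by
    rw [tendsto_iff_norm_sub_tendsto_zero]
    refine squeeze_zero' (Eventually.of_forall fun _ => norm_nonneg _) (eventually_atTop.2 ⟨2, hC⟩)
      ((Real.tendsto_log_atTop.comp tendsto_natCast_atTop_atTop).const_div_atTop K)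
  have hfe : Tendsto (fun u : ℝ => ⌊Real.exp u⌋₊) atTop atTop :=
    tendsto_nat_floor_atTop.comp Real.tendsto_exp_atTop
  have h2 := h1.comp hfe
  have h3 := Real.tendsto_harmonic_sub_log.comp (tendsto_nat_floor_atTop (α := ℝ))
  have h4 : Tendsto (fun u : ℝ => Real.log ⌊Real.exp u⌋₊ - u) atTop (nhds 0) := by
    simpa [Function.comp_def] using tendsto_log_floor_sub_log.comp Real.tendsto_exp_atTop
  have h5 : Tendsto (fun u : ℝ => Real.log (Real.log ⌊Real.exp u⌋₊) - Real.log u) atTop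
      (nhds 0) := by
    have h6 : Tendsto (fun u : ℝ => Real.log ⌊Real.exp u⌋₊ / u) atTop (nhds 1) := by
      have h7 : Tendsto (fun u : ℝ => (Real.log ⌊Real.exp u⌋₊ - u) / u + 1) atTop
          (nhds (0 + 1)) := (h4.div_atTop tendsto_id).add_const 1
      rw [zero_add] at h7
      refine h7.congr' ?_
      filter_upwards [eventually_gt_atTop 0] with u hu
      field_simp
      ring
    have h8 := (Real.continuousAt_log one_ne_zero).tendsto.comp h6
    rw [Real.log_one] at h8
    refine h8.congr' ?_
    filter_upwards [eventually_gt_atTop 0, hfe.eventually_ge_atTop 2] with u hu hu2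
    have : Real.log ⌊Real.exp u⌋₊ ≠ 0 := (Real.log_pos (by exact_mod_cast hu2)).ne'
    simp [Real.log_div this hu.ne']
  have h9 := ((h2.add h5).sub h3).sub tendsto_log_floor_sub_log
  rw [add_zero, sub_zero] at h9
  refine h9.congr fun u => ?_
  simp only [Function.comp, primeHarmonicDiff]
  ring

/-- Past some `U` the function is near its limit; before `U` both sums are nonnegative and monotone,
hence bounded by their values at `U`. -/
lemma exists_abs_primeHarmonicDiff_le {L : ℝ}
    (hL : Tendsto primeHarmonicDiff atTop (nhds L)) : ∃ B, ∀ u, |primeHarmonicDiff u| ≤ B := by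
  obtain ⟨U, hU⟩ := eventually_atTop.1 (hL.abs.eventually_le_const (lt_add_one |L|))
  set b := ∑ p ∈ Nat.primesLE ⌊Real.exp U⌋₊, 1 / (p : ℝ) + (harmonic ⌊U⌋₊ : ℝ)
  refine ⟨max (|L| + 1) b, fun u => ?_⟩
  rcases le_total U u with h | h
  · exact (hU u h).trans (le_max_left _ _)
  · refine le_trans ?_ (le_max_right _ _)
    have h1 : ∑ p ∈ Nat.primesLE ⌊Real.exp u⌋₊, 1 / (p : ℝ) ≤
        ∑ p ∈ Nat.primesLE ⌊Real.exp U⌋₊, 1 / (p : ℝ) :=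
      Finset.sum_le_sum_of_subset_of_nonneg
        (Nat.primesLE_mono (Nat.floor_le_floor (Real.exp_le_exp.2 h))) fun _ _ _ => by positivity
    have h2 : (harmonic ⌊u⌋₊ : ℝ) ≤ harmonic ⌊U⌋₊ := by
      rw [harmonic_cast_eq, harmonic_cast_eq]
      exact Finset.sum_le_sum_of_subset_of_nonneg
        (Finset.range_mono (Nat.floor_le_floor h)) fun _ _ _ => by positivity
    have h3 : 0 ≤ ∑ p ∈ Nat.primesLE ⌊Real.exp u⌋₊, 1 / (p : ℝ) :=
      Finset.sum_nonneg fun _ _ => by positivity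
    have h4 : (0 : ℝ) ≤ harmonic ⌊u⌋₊ := by
      rw [harmonic_cast_eq]
      exact Finset.sum_nonneg fun _ _ => by positivity
    unfold primeHarmonicDiff
    rw [abs_le]
    constructor <;> linarith

lemma abs_neg_log_one_sub_sub_le {x : ℝ} (h0 : 0 ≤ x) (h1 : x ≤ 1 / 2) :
    |-Real.log (1 - x) - x| ≤ 2 * x ^ 2 := by
  have h := Real.abs_log_sub_add_sum_range_le (x := x) (by rw [abs_of_nonneg h0]; linarith) 1
  simp only [Finset.sum_range_one, zero_add, pow_one, Nat.cast_zero, div_one, abs_of_nonneg h0] at h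
  rw [← abs_neg]
  have e : -(-Real.log (1 - x) - x) = x + Real.log (1 - x) := by ring
  rw [e]
  refine h.trans ?_
  rw [div_le_iff₀ (by linarith)]
  norm_num
  nlinarith [sq_nonneg x]

lemma Nat.Primes.two_le_cast (p : Nat.Primes) : (2 : ℝ) ≤ (p : ℕ) := by
  exact_mod_cast p.2.two_le

lemma Nat.Primes.summable_const_div_sq (A : ℝ) :
    Summable (fun p : Nat.Primes => A / ((p : ℕ) : ℝ) ^ 2) := by
  have h : Summable (fun n : ℕ => A / (n : ℝ) ^ 2) := by
    simpa [div_eq_mul_inv] using (Real.summable_nat_pow_inv.2 one_lt_two).mul_left A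
  exact h.comp_injective Nat.Primes.coe_nat_injective

lemma Nat.Primes.rpow_neg_one_add_le (p : Nat.Primes) {σ : ℝ} (hσ : 0 ≤ σ) :
    ((p : ℕ) : ℝ) ^ (-(1 + σ)) ≤ 1 / ((p : ℕ) : ℝ) := by
  have h := Real.rpow_le_rpow_of_exponent_le (x := ((p : ℕ) : ℝ)) (y := -(1 + σ)) (z := -1)
    (by linarith [p.two_le_cast]) (by linarith)
  rwa [Real.rpow_neg_one, ← one_div] at h

lemma Nat.Primes.norm_neg_log_one_sub_sub_le (p : Nat.Primes) {σ : ℝ} (hσ : 0 ≤ σ) :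
    ‖-Real.log (1 - ((p : ℕ) : ℝ) ^ (-(1 + σ))) - ((p : ℕ) : ℝ) ^ (-(1 + σ))‖ ≤
      2 / ((p : ℕ) : ℝ) ^ 2 := by
  have h1 := p.rpow_neg_one_add_le hσ
  have h0 : 0 ≤ ((p : ℕ) : ℝ) ^ (-(1 + σ)) := by positivity
  have h2 : 1 / ((p : ℕ) : ℝ) ≤ 1 / 2 :=
    one_div_le_one_div_of_le two_pos p.two_le_cast
  refine (abs_neg_log_one_sub_sub_le h0 (h1.trans h2)).trans ?_
  calc 2 * (((p : ℕ) : ℝ) ^ (-(1 + σ))) ^ 2 ≤ 2 * (1 / ((p : ℕ) : ℝ)) ^ 2 := by gcongr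
    _ = 2 / ((p : ℕ) : ℝ) ^ 2 := by rw [div_pow]; ring

lemma exp_tsum_neg_log_one_sub_rpow {s : ℝ} (hs : 1 < s) :
    ((Real.exp (∑' p : Nat.Primes, -Real.log (1 - ((p : ℕ) : ℝ) ^ (-s))) : ℝ) : ℂ) =
      riemannZeta s := by
  rw [← riemannZeta_eulerProduct_exp_log (s := (s : ℂ)) (by simpa using hs), Complex.ofReal_exp,
    Complex.ofReal_tsum]
  congr 1
  refine tsum_congr fun p => ?_
  have h2 := p.two_le_cast
  have h : ((p : ℕ) : ℝ) ^ (-s) ≤ 1 :=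
    Real.rpow_le_one_of_one_le_of_nonpos (by linarith) (by linarith)
  rw [Complex.ofReal_neg, Complex.ofReal_log (by linarith), Complex.ofReal_sub,
    Complex.ofReal_cpow (by linarith)]
  simp

/-- This is `log (σ ζ(1+σ)) → log 1`, by the residue of `ζ` at 1 and the Euler product. -/
lemma tendsto_log_add_tsum_neg_log :
    Tendsto (fun σ : ℝ => Real.log σ +
      ∑' p : Nat.Primes, -Real.log (1 - ((p : ℕ) : ℝ) ^ (-(1 + σ))))
      (nhdsWithin 0 (Set.Ioi 0)) (nhds 0) := by
  have hmap : Tendsto (fun σ : ℝ => ((1 + σ : ℝ) : ℂ)) (nhdsWithin 0 (Set.Ioi 0))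
      (nhdsWithin 1 {1}ᶜ) := by
    refine tendsto_nhdsWithin_iff.2 ⟨?_, ?_⟩
    · have : Continuous (fun σ : ℝ => ((1 + σ : ℝ) : ℂ)) := by fun_prop
      simpa using (this.tendsto 0).mono_left nhdsWithin_le_nhds
    · filter_upwards [self_mem_nhdsWithin] with σ hσ
      have : σ ≠ 0 := (Set.mem_Ioi.1 hσ).ne'
      simp [this]
  have h := (Complex.continuous_re.tendsto 1).comp (riemannZeta_residue_one.comp hmap)
  rw [Complex.one_re] at h
  have h2 := (Real.continuousAt_log one_ne_zero).tendsto.comp h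
  rw [Real.log_one] at h2
  refine h2.congr' ?_
  filter_upwards [self_mem_nhdsWithin] with σ hσ
  have hσ' : 0 < σ := hσ
  have e : (((1 + σ : ℝ) : ℂ) - 1) = (σ : ℂ) := by push_cast; ring
  simp only [Function.comp]
  rw [← exp_tsum_neg_log_one_sub_rpow (by linarith : 1 < 1 + σ), e, ← Complex.ofReal_mul,
    Complex.ofReal_re, Real.log_mul hσ'.ne' (Real.exp_pos _).ne', Real.log_exp]

/-- `1 - e^(-σ)` has slope 1 at 0. -/
lemma tendsto_log_sub_log_one_sub_exp_neg :
    Tendsto (fun σ : ℝ => Real.log σ - Real.log (1 - Real.exp (-σ)))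
      (nhdsWithin 0 (Set.Ioi 0)) (nhds 0) := by
  have hd : HasDerivAt (fun σ : ℝ => 1 - Real.exp (-σ)) 1 0 := by
    have h := ((hasDerivAt_neg (0 : ℝ)).exp).const_sub 1
    simpa using h
  have h1 := (hasDerivAt_iff_tendsto_slope.1 hd).mono_left
    (nhdsWithin_mono (0 : ℝ) (fun x (hx : x ∈ Set.Ioi 0) => (Set.mem_Ioi.1 hx).ne'))
  have h2 := ((Real.continuousAt_log one_ne_zero).tendsto.comp h1).neg
  rw [Real.log_one, neg_zero] at h2
  refine h2.congr' ?_
  filter_upwards [self_mem_nhdsWithin] with σ hσ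
  have hσ' : 0 < σ := hσ
  have h3 : 0 < 1 - Real.exp (-σ) := by
    have : Real.exp (-σ) < 1 := Real.exp_lt_one_iff.2 (by linarith)
    linarith
  simp [slope_def_field, Real.log_div h3.ne' hσ'.ne']

lemma tendsto_tsum_neg_log_one_sub_sub :
    Tendsto (fun σ : ℝ => ∑' p : Nat.Primes,
      (-Real.log (1 - ((p : ℕ) : ℝ) ^ (-(1 + σ))) - ((p : ℕ) : ℝ) ^ (-(1 + σ))))
      (nhdsWithin 0 (Set.Ioi 0))
      (nhds (∑' p : Nat.Primes, (-Real.log (1 - 1 / ((p : ℕ) : ℝ)) - 1 / ((p : ℕ) : ℝ)))) := by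
  refine tendsto_tsum_of_dominated_convergence (Nat.Primes.summable_const_div_sq 2)
    (fun p => ?_) ?_
  · have hp := p.two_le_cast
    have hc : ContinuousAt (fun σ : ℝ => ((p : ℕ) : ℝ) ^ (-(1 + σ))) 0 :=
      (Real.continuousAt_const_rpow (by linarith)).comp (by fun_prop)
    have e : ((p : ℕ) : ℝ) ^ (-(1 + (0 : ℝ))) = 1 / ((p : ℕ) : ℝ) := by
      rw [add_zero, Real.rpow_neg_one, one_div]
    have h1 : 1 / ((p : ℕ) : ℝ) ≤ 1 / 2 := one_div_le_one_div_of_le two_pos hp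
    have hc2 : ContinuousAt (fun σ : ℝ =>
        -Real.log (1 - ((p : ℕ) : ℝ) ^ (-(1 + σ))) - ((p : ℕ) : ℝ) ^ (-(1 + σ))) 0 := by
      refine ContinuousAt.sub (ContinuousAt.neg (ContinuousAt.log
        (continuousAt_const.sub hc) ?_)) hc
      rw [e]
      linarith
    have h2 := hc2.tendsto
    rw [e] at h2
    exact h2.mono_left nhdsWithin_le_nhds
  · filter_upwards [self_mem_nhdsWithin] with σ hσ p
    exact p.norm_neg_log_one_sub_sub_le (le_of_lt hσ)

/-- The constant in Mertens' second theorem. -/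
lemma mertens_constant_eq {C K : ℝ}
    (hC : ∀ n : ℕ, 2 ≤ n →
      |∑ p ∈ Nat.primesLE n, 1 / (p : ℝ) - Real.log (Real.log n) - C| ≤ K / Real.log n) :
    C = Real.eulerMascheroniConstant +
      ∑' p : Nat.Primes, (Real.log (1 - 1 / ((p : ℕ) : ℝ)) + 1 / ((p : ℕ) : ℝ)) := by
  have hL := tendsto_primeHarmonicDiff hC
  obtain ⟨B, hB⟩ := exists_abs_primeHarmonicDiff_le hL
  have hpexp : ∀ (σ : ℝ) (p : Nat.Primes),
      1 / ((p : ℕ) : ℝ) * Real.exp (-(σ * Real.log (p : ℕ))) =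
        ((p : ℕ) : ℝ) ^ (-(1 + σ)) := by
    intro σ p
    have hp : (0 : ℝ) < (p : ℕ) := by linarith [p.two_le_cast]
    rw [neg_add, Real.rpow_add hp, Real.rpow_neg_one, one_div, Real.rpow_def_of_pos hp]
    congr 2
    ring
  have hnexp : ∀ (σ : ℝ) (n : ℕ),
      1 / ((n : ℝ) + 1) * Real.exp (-(σ * ((n : ℝ) + 1))) =
        Real.exp (-σ) ^ (n + 1) / (n + 1) := by
    intro σ n
    rw [← Real.exp_nat_mul, one_div_mul_eq_div]
    congr 2
    push_cast
    ring
  have hsp : ∀ σ : ℝ, 0 < σ → Summable (fun p : Nat.Primes => ((p : ℕ) : ℝ) ^ (-(1 + σ))) :=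
    fun σ hσ => Nat.Primes.summable_rpow.2 (by linarith)
  have hsn : ∀ σ : ℝ, 0 < σ → HasSum (fun n : ℕ => Real.exp (-σ) ^ (n + 1) / ((n : ℝ) + 1))
      (-Real.log (1 - Real.exp (-σ))) := fun σ hσ => by
    refine Real.hasSum_pow_div_log_of_abs_lt_one ?_
    rw [Real.abs_exp]
    exact Real.exp_lt_one_iff.2 (by linarith)
  -- Primes carry frequency `log p` and positive integers `n + 1` carry frequency `n + 1` with
  -- negative weight, so the summatory function is `primeHarmonicDiff`.
  have hA := tendsto_tsum_mul_exp_neg (ι := Nat.Primes ⊕ ℕ)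
    (c := Sum.elim (fun p => 1 / ((p : ℕ) : ℝ)) (fun n => -(1 / ((n : ℝ) + 1))))
    (l := Sum.elim (fun p => Real.log (p : ℕ)) (fun n => (n : ℝ) + 1))
    (by
      rintro (p | n)
      · exact Real.log_pos (by linarith [p.two_le_cast])
      · simp only [Sum.elim_inr]
        positivity)
    measurable_primeHarmonicDiff hB hL
    (by
      intro u
      refine HasSum.sum ?_ ?_
      · refine (hasSum_primes_ite_le (fun n => 1 / (n : ℝ)) ⌊Real.exp u⌋₊).congr_fun fun p => ?_
        have hp : (0 : ℝ) < (p : ℕ) := by linarith [p.two_le_cast]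
        simp only [Function.comp, Sum.elim_inl, Nat.le_floor_iff (Real.exp_pos u).le,
          Real.log_le_iff_le_exp hp]
      · rw [harmonic_cast_eq, ← Finset.sum_neg_distrib]
        have h : ∀ n : ℕ, n ∈ Finset.range ⌊u⌋₊ ↔ (n : ℝ) + 1 ≤ u := fun n => by
          rw [Finset.mem_range, ← Nat.succ_le_iff, Nat.le_floor_iff' (Nat.succ_ne_zero n)]
          push_cast
          rfl
        rw [← Finset.sum_congr rfl fun n hn => if_pos ((h n).1 hn) (e := (0 : ℝ))]
        exact hasSum_sum_of_ne_finset_zero fun n hn => if_neg (mt (h n).2 hn))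
    (by
      intro σ hσ
      refine Summable.sum _ ?_ ?_
      · refine (hsp σ hσ).congr fun p => ?_
        simp only [Function.comp, Sum.elim_inl]
        rw [abs_of_nonneg (by positivity), hpexp]
      · refine (hsn σ hσ).summable.congr fun n => ?_
        simp only [Function.comp, Sum.elim_inr]
        rw [abs_neg, abs_of_nonneg (by positivity), hnexp])
  have hB2 := ((tendsto_log_add_tsum_neg_log.sub tendsto_log_sub_log_one_sub_exp_neg).sub
    tendsto_tsum_neg_log_one_sub_sub)
  have huniq := tendsto_nhds_unique hA (hB2.congr' (by
    filter_upwards [self_mem_nhdsWithin] with σ hσ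
    have hσ' : 0 < σ := hσ
    have h1 : HasSum (fun p : Nat.Primes => 1 / ((p : ℕ) : ℝ) *
        Real.exp (-(σ * Real.log (p : ℕ)))) (∑' p : Nat.Primes, ((p : ℕ) : ℝ) ^ (-(1 + σ))) := by
      simp only [hpexp]
      exact (hsp σ hσ').hasSum
    have h2 : HasSum (fun n : ℕ => -(1 / ((n : ℝ) + 1)) * Real.exp (-(σ * ((n : ℝ) + 1))))
        (Real.log (1 - Real.exp (-σ))) := by
      simp only [neg_mul, hnexp]
      simpa using (hsn σ hσ').neg
    rw [(HasSum.sum (f := fun i : Nat.Primes ⊕ ℕ => Sum.elim (fun p : Nat.Primes =>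
      1 / ((p : ℕ) : ℝ)) (fun n : ℕ => -(1 / ((n : ℝ) + 1))) i * Real.exp (-(σ * Sum.elim
      (fun p : Nat.Primes => Real.log (p : ℕ)) (fun n : ℕ => (n : ℝ) + 1) i))) h1 h2).tsum_eq]
    have h3 : Summable (fun p : Nat.Primes =>
        (-Real.log (1 - ((p : ℕ) : ℝ) ^ (-(1 + σ))) - ((p : ℕ) : ℝ) ^ (-(1 + σ)))) :=
      (Nat.Primes.summable_const_div_sq 2).of_norm_bounded
        fun p => p.norm_neg_log_one_sub_sub_le hσ'.le
    have h4 : Summable (fun p : Nat.Primes => -Real.log (1 - ((p : ℕ) : ℝ) ^ (-(1 + σ)))) :=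
      (h3.add (hsp σ hσ')).congr fun p => by ring
    rw [h4.tsum_sub (hsp σ hσ')]
    ring))
  have hneg : ∑' p : Nat.Primes, (-Real.log (1 - 1 / ((p : ℕ) : ℝ)) - 1 / ((p : ℕ) : ℝ)) =
      -∑' p : Nat.Primes, (Real.log (1 - 1 / ((p : ℕ) : ℝ)) + 1 / ((p : ℕ) : ℝ)) := by
    rw [← tsum_neg]
    exact tsum_congr fun p => by ring
  rw [hneg] at huniq
  linarith

/-! ### Exact formula for the sum over tuples -/

/-- A prime dividing `m` has weight `v_p(m) - 1`, the number of exponents `a + 2 ≤ v_p(m)`. `T` and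
`N` need only be large enough, so one index range can serve all tuples. -/
lemma alladiErdosB_eq_sum {m N : ℕ} {T : Finset ℕ} (hm : m ≠ 0) (hT : ∀ p ∈ T, p.Prime)
    (hsq : ∀ p, p.Prime → p ^ 2 ∣ m → p ∈ T) (hN : ∀ p, m.factorization p ≤ N) :
    alladiErdosB m = ∑ p ∈ T, ∑ a ∈ Finset.range N, if p ^ (a + 2) ∣ m then (p : ℝ) else 0 := by
  have h1 : alladiErdosB m =
      ∑ p ∈ m.primeFactors, ((m.factorization p - 1 : ℕ) : ℝ) * p := by
    simp only [alladiErdosB, alladiErdosA, alladiErdosAStar, Nat.cast_sum, Nat.cast_mul]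
    rw [← Finset.sum_sub_distrib]
    refine Finset.sum_congr rfl fun p hp => ?_
    have hp' := Nat.mem_primeFactors.1 hp
    have : 1 ≤ m.factorization p :=
      (hp'.1.dvd_iff_one_le_factorization hm).1 hp'.2.1
    rw [Nat.cast_sub this]
    push_cast
    ring
  have h2 : ∀ p ∈ T, (∑ a ∈ Finset.range N, if p ^ (a + 2) ∣ m then (p : ℝ) else 0) =
      ((m.factorization p - 1 : ℕ) : ℝ) * p := by
    intro p hp
    rw [← Finset.sum_filter, Finset.sum_const, nsmul_eq_mul]
    congr 2
    have : (Finset.range N).filter (fun a => p ^ (a + 2) ∣ m) =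
        Finset.range (m.factorization p - 1) := by
      ext a
      have := hN p
      rw [Finset.mem_filter, (hT p hp).pow_dvd_iff_le_factorization hm, Finset.mem_range,
        Finset.mem_range]
      omega
    rw [this, Finset.card_range]
  rw [h1, Finset.sum_congr rfl h2]
  have h3 : ∑ p ∈ m.primeFactors, ((m.factorization p - 1 : ℕ) : ℝ) * p =
      ∑ p ∈ m.primeFactors ∪ T, ((m.factorization p - 1 : ℕ) : ℝ) * p := by
    refine Finset.sum_subset Finset.subset_union_left fun p _ hp => ?_
    have : m.factorization p = 0 := by
      rwa [← Nat.support_factorization, Finsupp.notMem_support_iff] at hp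
    simp [this]
  have h4 : ∑ p ∈ T, ((m.factorization p - 1 : ℕ) : ℝ) * p =
      ∑ p ∈ m.primeFactors ∪ T, ((m.factorization p - 1 : ℕ) : ℝ) * p := by
    refine Finset.sum_subset Finset.subset_union_right fun p hp hpT => ?_
    have hpp : p.Prime := by
      rcases Finset.mem_union.1 hp with h | h
      · exact Nat.prime_of_mem_primeFactors h
      · exact hT p h
    have : ¬ 2 ≤ m.factorization p := fun h =>
      hpT (hsq p hpp ((hpp.pow_dvd_iff_le_factorization hm).2 h))
    have : m.factorization p - 1 = 0 := by omega
    simp [this]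
  rw [h3, h4]

lemma Nat.Prime.pow_dvd_finset_lcm_iff {ι : Type*} {s : Finset ι} {f : ι → ℕ}
    (hf : ∀ i ∈ s, f i ≠ 0) {p a : ℕ} (hp : p.Prime) (ha : 0 < a) :
    p ^ a ∣ s.lcm f ↔ ∃ i ∈ s, p ^ a ∣ f i := by
  have h0 : s.lcm f ≠ 0 := by
    rw [Ne, Finset.lcm_eq_zero_iff]
    simpa using hf
  rw [hp.pow_dvd_iff_le_factorization h0, Finset.factorization_lcm hf,
    Finset.le_sup_iff (by simpa using ha)]
  exact exists_congr fun i => and_congr_right fun hi =>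
    (hp.pow_dvd_iff_le_factorization (hf i hi)).symm

/-- The complement, where no coordinate is divisible by `d`, is a product set. -/
lemma card_filter_exists_dvd (k N d : ℕ) :
    (((Fintype.piFinset (fun _ : Fin k => Finset.Icc 1 N)).filter
      (fun n => ∃ i, d ∣ n i)).card : ℝ) =
      (N : ℝ) ^ k - ((N : ℝ) - (N / d : ℕ)) ^ k := by
  have h1 := Finset.card_filter_add_card_filter_not
    (s := Fintype.piFinset (fun _ : Fin k => Finset.Icc 1 N)) (fun n => ∃ i, d ∣ n i)
  have h2 : (Fintype.piFinset (fun _ : Fin k => Finset.Icc 1 N)).filter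
      (fun n => ¬ ∃ i, d ∣ n i) =
      Fintype.piFinset (fun _ : Fin k => (Finset.Icc 1 N).filter (fun m => ¬ d ∣ m)) := by
    ext n
    simp only [Finset.mem_filter, Fintype.mem_piFinset, not_exists, forall_and]
  have h3 : ((Finset.Icc 1 N).filter (fun m => ¬ d ∣ m)).card + N / d = N := by
    have h4 := Finset.card_filter_add_card_filter_not (s := Finset.Icc 1 N) (fun m => d ∣ m)
    have h5 : ((Finset.Icc 1 N).filter (fun m => d ∣ m)).card = N / d := by
      rw [← Nat.Ioc_filter_dvd_card_eq_div]
      rfl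
    rw [h5, Nat.card_Icc] at h4
    omega
  rw [h2] at h1
  simp only [Fintype.card_piFinset_const, Nat.card_Icc, Nat.add_sub_cancel] at h1
  have h6 : (((Finset.Icc 1 N).filter (fun m => ¬ d ∣ m)).card : ℝ) = (N : ℝ) - (N / d : ℕ) := by
    rw [eq_sub_iff_add_eq]
    exact_mod_cast h3
  rw [← h6, eq_sub_iff_add_eq]
  exact_mod_cast h1

lemma sumBLcm_eq (k : ℕ) (x : ℝ) :
    sumBLcm k x = ∑ p ∈ Nat.primesLE (Nat.sqrt ⌊x⌋₊), (p : ℝ) * ∑ a ∈ Finset.range ⌊x⌋₊,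
      (((⌊x⌋₊ : ℕ) : ℝ) ^ k - (((⌊x⌋₊ : ℕ) : ℝ) - (⌊x⌋₊ / p ^ (a + 2) : ℕ)) ^ k) := by
  set N := ⌊x⌋₊ with hN
  have hB : ∀ n ∈ Fintype.piFinset (fun _ : Fin k => Finset.Icc 1 N),
      alladiErdosB (Finset.univ.lcm n) = ∑ p ∈ Nat.primesLE (Nat.sqrt N),
        ∑ a ∈ Finset.range N, if ∃ i, p ^ (a + 2) ∣ n i then (p : ℝ) else 0 := by
    intro n hn
    have hmem : ∀ i, 1 ≤ n i ∧ n i ≤ N := fun i =>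
      Finset.mem_Icc.1 (Fintype.mem_piFinset.1 hn i)
    have hne : ∀ i ∈ Finset.univ, n i ≠ 0 := fun i _ => by
      have := (hmem i).1
      omega
    have h0 : Finset.univ.lcm n ≠ 0 := by
      rw [Ne, Finset.lcm_eq_zero_iff]
      simpa using fun i => hne i (Finset.mem_univ i)
    rw [alladiErdosB_eq_sum (T := Nat.primesLE (Nat.sqrt N)) (N := N) h0
      (fun p hp => Nat.prime_of_mem_primesLE hp)]
    · refine Finset.sum_congr rfl fun p hp => Finset.sum_congr rfl fun a _ => ?_
      have hiff := (Nat.prime_of_mem_primesLE hp).pow_dvd_finset_lcm_iff hne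
        (a := a + 2) (by omega)
      simp only [Finset.mem_univ, true_and] at hiff
      simp only [hiff]
    -- If `p ^ 2` divides the lcm it divides some `n i ≤ N`, hence `p ≤ √N`.
    · intro p hp hd
      obtain ⟨i, _, hi⟩ := (hp.pow_dvd_finset_lcm_iff hne two_pos).1 hd
      refine Nat.mem_primesLE.2 ⟨Nat.le_sqrt'.2 ?_, hp⟩
      exact (Nat.le_of_dvd (hmem i).1 hi).trans (hmem i).2
    · intro p
      rw [Finset.factorization_lcm hne]
      refine Finset.sup_le fun i _ => ?_
      exact ((Nat.factorization_lt p (hne i (Finset.mem_univ i))).le).trans (hmem i).2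
  rw [sumBLcm, Finset.sum_congr rfl hB, Finset.sum_comm]
  refine Finset.sum_congr rfl fun p _ => ?_
  rw [Finset.sum_comm, Finset.mul_sum]
  refine Finset.sum_congr rfl fun a _ => ?_
  rw [← Finset.sum_filter, Finset.sum_const, nsmul_eq_mul, card_filter_exists_dvd, mul_comm]

/-! ### Main term and error at each prime -/

/-- The coefficient of `u ^ j` in `1 - (1 - u) ^ k`. -/
noncomputable def lcmCoeff (k j : ℕ) : ℝ := (-1 : ℝ) ^ (j - 1) * (k.choose j : ℝ)

/-- `n ↦ 1 / (n ^ (j - 1) (n ^ j - 1))`. -/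
noncomputable def invPowMul (j n : ℕ) : ℝ := 1 / ((n : ℝ) ^ (j - 1) * ((n : ℝ) ^ j - 1))

lemma one_sub_one_sub_pow (k : ℕ) (u : ℝ) :
    1 - (1 - u) ^ k = ∑ j ∈ Finset.Icc 1 k, lcmCoeff k j * u ^ j := by
  have h : (1 - u) ^ k = ∑ j ∈ Finset.range (k + 1), (-u) ^ j * (k.choose j : ℝ) := by
    have := add_pow (-u) 1 k
    simp only [one_pow, mul_one] at this
    rw [← this]
    ring
  rw [h, Finset.range_eq_Ico, Finset.sum_eq_sum_Ico_succ_bot (Nat.succ_pos k)]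
  simp only [pow_zero, Nat.choose_zero_right, Nat.cast_one, mul_one, zero_add, sub_add_cancel_left]
  rw [← Finset.sum_neg_distrib]
  refine Finset.sum_congr rfl fun j hj => ?_
  obtain ⟨i, rfl⟩ : ∃ i, j = i + 1 := ⟨j - 1, by have := (Finset.mem_Ico.1 hj).1; omega⟩
  rw [lcmCoeff, neg_pow, Nat.add_sub_cancel]
  ring

/-- Binomial expansion, then for each `j` a geometric series in `a` with first term `p^(1-2j)` and
ratio `p^(-j)`. -/
lemma hasSum_mul_one_sub_pow {p : ℕ} (hp : 2 ≤ p) (k : ℕ) :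
    HasSum (fun a : ℕ => (p : ℝ) * (1 - (1 - 1 / (p : ℝ) ^ (a + 2)) ^ k))
      (∑ j ∈ Finset.Icc 1 k, lcmCoeff k j * invPowMul j p) := by
  have hp' : (2 : ℝ) ≤ p := by exact_mod_cast hp
  have h0 : (0 : ℝ) < p := by linarith
  have h1 : ∀ j ∈ Finset.Icc 1 k, HasSum (fun a : ℕ =>
      lcmCoeff k j * (p * (1 / (p : ℝ) ^ (a + 2)) ^ j)) (lcmCoeff k j * invPowMul j p) := by
    intro j hj
    obtain ⟨i, rfl⟩ : ∃ i, j = i + 1 := ⟨j - 1, by have := (Finset.mem_Icc.1 hj).1; omega⟩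
    refine HasSum.mul_left _ ?_
    have hr0 : 0 ≤ 1 / (p : ℝ) ^ (i + 1) := by positivity
    have hr2 : 1 < (p : ℝ) ^ (i + 1) := one_lt_pow₀ (by linarith) (by omega)
    have hr1 : 1 / (p : ℝ) ^ (i + 1) < 1 := by
      rw [div_lt_one (by positivity)]
      exact hr2
    have hg := (hasSum_geometric_of_lt_one hr0 hr1).mul_left
      ((p : ℝ) * (1 / (p : ℝ) ^ (i + 1)) ^ 2)
    have e1 : (p : ℝ) * (1 / (p : ℝ) ^ (i + 1)) ^ 2 * (1 - 1 / (p : ℝ) ^ (i + 1))⁻¹ =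
        invPowMul (i + 1) p := by
      have h3 : (p : ℝ) ^ (i + 1) - 1 ≠ 0 := by linarith
      have h4 : 1 - 1 / (p : ℝ) ^ (i + 1) = ((p : ℝ) ^ (i + 1) - 1) / (p : ℝ) ^ (i + 1) := by
        field_simp
      rw [h4, invPowMul, Nat.add_sub_cancel, inv_div]
      field_simp
      ring
    rw [e1] at hg
    refine hg.congr_fun fun a => ?_
    rw [mul_assoc, ← pow_add, div_pow, div_pow, one_pow, one_pow, ← pow_mul, ← pow_mul]
    congr 3
    ring
  refine (hasSum_sum h1).congr_fun fun a => ?_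
  rw [one_sub_one_sub_pow, Finset.mul_sum]
  exact Finset.sum_congr rfl fun j _ => by ring

/-- `t ↦ t^k` is Lipschitz on `[-N, N]` with constant `k N^(k-1)`. The rounding error is at most 1,
and at most `N/d`, which makes the sum over large `d` converge. -/
lemma abs_pow_sub_floor_sub_le {N d k : ℕ} (hd : 0 < d) :
    |((N : ℝ) ^ k - ((N : ℝ) - (N / d : ℕ)) ^ k) - (N : ℝ) ^ k * (1 - (1 - 1 / (d : ℝ)) ^ k)| ≤
      k * (N : ℝ) ^ (k - 1) * min (1 : ℝ) ((N : ℝ) / d) := by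
  have hd' : (1 : ℝ) ≤ d := by exact_mod_cast hd
  have hM1 : ((N / d : ℕ) : ℝ) ≤ N / d := Nat.cast_div_le
  have hM2 : (N : ℝ) / d < (N / d : ℕ) + 1 := by
    have := Nat.lt_floor_add_one ((N : ℝ) / d)
    rwa [Nat.floor_div_natCast, Nat.floor_natCast] at this
  have hM0 : (0 : ℝ) ≤ (N / d : ℕ) := Nat.cast_nonneg _
  have hN0 : (0 : ℝ) ≤ N := Nat.cast_nonneg _
  have hNd : (N : ℝ) / d ≤ N := div_le_self hN0 hd'
  have e : ((N : ℝ) ^ k - ((N : ℝ) - (N / d : ℕ)) ^ k) -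
      (N : ℝ) ^ k * (1 - (1 - 1 / (d : ℝ)) ^ k) =
      ((N : ℝ) - N / d) ^ k - ((N : ℝ) - (N / d : ℕ)) ^ k := by
    rw [mul_sub, ← mul_pow]
    ring
  rw [e]
  refine (abs_pow_sub_pow_le _ _ _).trans ?_
  have h1 : |((N : ℝ) - N / d) - ((N : ℝ) - (N / d : ℕ))| ≤ min (1 : ℝ) ((N : ℝ) / d) := by
    rw [abs_sub_comm, abs_of_nonneg (by linarith)]
    exact le_min (by linarith) (by linarith)
  have h2 : max |(N : ℝ) - N / d| |(N : ℝ) - (N / d : ℕ)| ≤ N := by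
    refine max_le ?_ ?_ <;> rw [abs_le] <;> constructor <;> linarith
  have h3 : 0 ≤ max |(N : ℝ) - N / d| |(N : ℝ) - (N / d : ℕ)| :=
    (abs_nonneg _).trans (le_max_left _ _)
  calc _ ≤ min 1 ((N : ℝ) / d) * k * (N : ℝ) ^ (k - 1) := by gcongr
    _ = _ := by ring

lemma hasSum_geometric_after (L : ℕ) :
    HasSum (fun a : ℕ => if a < L then (1 : ℝ) else (1 / 2) ^ (a - L + 1)) (L + 1) := by
  have h : HasSum (fun a : ℕ => (1 / 2 : ℝ) ^ (a + 1)) 1 := by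
    have := (hasSum_geometric_of_lt_one (r := (1 / 2 : ℝ)) (by norm_num) (by norm_num)).mul_right
      (1 / 2)
    norm_num at this
    simpa [pow_succ] using this
  rw [← hasSum_nat_add_iff' L]
  have e : (L : ℝ) + 1 - ∑ i ∈ Finset.range L, (if i < L then (1 : ℝ) else (1 / 2) ^ (i - L + 1)) =
      1 := by
    rw [Finset.sum_congr rfl fun i hi => if_pos (Finset.mem_range.1 hi)]
    simp
  rw [e]
  simpa using h

/-- As `N < p^(log_p N + 1)`, every exponent beyond that gains a factor at most `1/2`. The majorant
sums to `log_p N + 1`. -/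
lemma min_one_div_pow_le {N p : ℕ} (hp : 2 ≤ p) (a : ℕ) :
    min 1 ((N : ℝ) / (p ^ (a + 2) : ℕ)) ≤
      if a < Nat.log p N then (1 : ℝ) else (1 / 2) ^ (a - Nat.log p N + 1) := by
  split_ifs with h
  · exact min_le_left _ _
  · refine (min_le_right _ _).trans ?_
    have hp0 : (2 : ℝ) ≤ p := by exact_mod_cast hp
    have hN : N < p ^ (Nat.log p N + 1) := Nat.lt_pow_succ_log_self (by omega) N
    have hN' : (N : ℝ) ≤ (p : ℝ) ^ (Nat.log p N + 1) := by exact_mod_cast hN.le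
    obtain ⟨i, hi⟩ := Nat.exists_eq_add_of_le (not_lt.1 h)
    generalize Nat.log p N = L at *
    subst hi
    rw [Nat.add_sub_cancel_left, div_pow, one_pow]
    push_cast
    rw [div_le_div_iff₀ (by positivity) (by positivity)]
    calc (N : ℝ) * 2 ^ (i + 1) ≤ (p : ℝ) ^ (L + 1) * (p : ℝ) ^ (i + 1) := by gcongr
      _ = 1 * (p : ℝ) ^ (L + i + 2) := by rw [← pow_add]; ring

lemma abs_prime_term_sub_le {N p : ℕ} (hp : 2 ≤ p) (k : ℕ) :
    |(p : ℝ) * ∑ a ∈ Finset.range N,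
        ((N : ℝ) ^ k - ((N : ℝ) - (N / p ^ (a + 2) : ℕ)) ^ k) -
      (N : ℝ) ^ k * ∑ j ∈ Finset.Icc 1 k, lcmCoeff k j * invPowMul j p| ≤
      k * (N : ℝ) ^ (k - 1) * (p * (Nat.log p N + 1)) := by
  have h1 : HasSum (fun a : ℕ => (N : ℝ) ^ k - ((N : ℝ) - (N / p ^ (a + 2) : ℕ)) ^ k)
      (∑ a ∈ Finset.range N, ((N : ℝ) ^ k - ((N : ℝ) - (N / p ^ (a + 2) : ℕ)) ^ k)) := by
    -- For `a ≥ N` the floor is zero, so the finite sum is already the whole series.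
    refine hasSum_sum_of_ne_finset_zero fun a ha => ?_
    have h : N < p ^ (a + 2) := by
      have h2 : a + 2 < p ^ (a + 2) := Nat.lt_pow_self (by omega)
      rw [Finset.mem_range] at ha
      omega
    simp [Nat.div_eq_of_lt h]
  have h2 := (h1.mul_left (p : ℝ)).sub ((hasSum_mul_one_sub_pow hp k).mul_left ((N : ℝ) ^ k))
  have h3 := ((hasSum_geometric_after (Nat.log p N)).mul_left (p : ℝ)).mul_left
    (k * (N : ℝ) ^ (k - 1))
  rw [← h2.tsum_eq, ← Real.norm_eq_abs]
  refine tsum_of_norm_bounded h3 fun a => ?_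
  have h4 := abs_pow_sub_floor_sub_le (N := N) (k := k) (d := p ^ (a + 2)) (by positivity)
  have e : (p : ℝ) * ((N : ℝ) ^ k - ((N : ℝ) - (N / p ^ (a + 2) : ℕ)) ^ k) -
      (N : ℝ) ^ k * ((p : ℝ) * (1 - (1 - 1 / (p : ℝ) ^ (a + 2)) ^ k)) =
      (p : ℝ) * (((N : ℝ) ^ k - ((N : ℝ) - (N / p ^ (a + 2) : ℕ)) ^ k) -
        (N : ℝ) ^ k * (1 - (1 - 1 / ((p ^ (a + 2) : ℕ) : ℝ)) ^ k)) := by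
    push_cast
    ring
  rw [e, Real.norm_eq_abs, abs_mul, Nat.abs_cast]
  calc _ ≤ (p : ℝ) * (k * (N : ℝ) ^ (k - 1) * min 1 ((N : ℝ) / (p ^ (a + 2) : ℕ))) := by gcongr
    _ ≤ (p : ℝ) * (k * (N : ℝ) ^ (k - 1) *
        (if a < Nat.log p N then (1 : ℝ) else (1 / 2) ^ (a - Nat.log p N + 1))) := by
      gcongr
      exact min_one_div_pow_le hp a
    _ = _ := by ring

/-- `log t / t` decreases for `t ≥ e`, so `p / log p` is at most `√N / log √N`. One factor 2 absorbs
the `+ 1`, the other is `log N = 2 log √N`. -/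
lemma prime_mul_natLog_add_one_le {N p : ℕ} (hp : 2 ≤ p) (hpN : p ≤ Nat.sqrt N) (hN : 16 ≤ N) :
    (p : ℝ) * (Nat.log p N + 1) ≤ 4 * √(N : ℝ) := by
  have hp0 : (2 : ℝ) ≤ p := by exact_mod_cast hp
  have hN0 : (16 : ℝ) ≤ N := by exact_mod_cast hN
  set y := √(N : ℝ) with hy
  have hy4 : 4 ≤ y := Real.le_sqrt_of_sq_le (by linarith)
  have hyN : y ^ 2 = N := Real.sq_sqrt (by linarith)
  have hpy : (p : ℝ) ≤ y := by
    refine Real.le_sqrt_of_sq_le ?_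
    exact_mod_cast Nat.le_sqrt'.1 hpN
  have hlogp : 0 < Real.log p := Real.log_pos (by linarith)
  have hlogN : Real.log N = 2 * Real.log y := by
    rw [← hyN, Real.log_pow]
    norm_num
  have hlogle : Real.log p ≤ Real.log y := Real.log_le_log (by linarith) hpy
  have h1 : (Nat.log p N : ℝ) ≤ Real.log N / Real.log p := Real.natLog_le_logb N p
  have h2 : 1 ≤ Real.log N / Real.log p := by
    rw [le_div_iff₀ hlogp]
    linarith
  have h3 : Real.log y / y ≤ Real.log p / p := by
    have hexp : Real.exp 1 ≤ 3 := by linarith [Real.exp_one_lt_d9]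
    -- The prime 2 lies below `e`; there `log 2 / 2 = log 4 / 4` and `√N ≥ 4` replace monotonicity.
    rcases eq_or_lt_of_le hp with rfl | hp3
    · have h4 := Real.log_div_self_antitoneOn (a := 4) (b := y)
        (Set.mem_Ici.2 (by linarith)) (Set.mem_Ici.2 (by linarith)) hy4
      refine h4.trans (le_of_eq ?_)
      have : Real.log 4 = 2 * Real.log 2 := by
        rw [show (4 : ℝ) = 2 ^ 2 by norm_num, Real.log_pow]
        norm_num
      simp only [this]
      push_cast
      ring
    · have hp3' : (3 : ℝ) ≤ p := by exact_mod_cast hp3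
      exact Real.log_div_self_antitoneOn (Set.mem_Ici.2 (by linarith))
        (Set.mem_Ici.2 (by linarith)) hpy
  have h5 : (p : ℝ) * Real.log y ≤ y * Real.log p := by
    rw [div_le_div_iff₀ (by linarith) (by linarith)] at h3
    linarith
  calc (p : ℝ) * (Nat.log p N + 1) ≤ p * (2 * (Real.log N / Real.log p)) := by
        gcongr
        linarith
    _ = 4 * (p * Real.log y) / Real.log p := by rw [hlogN]; ring
    _ ≤ 4 * (y * Real.log p) / Real.log p := by gcongr
    _ = 4 * y := by field_simp

lemma eventually_sum_prime_mul_natLog_le :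
    ∀ᶠ N : ℕ in atTop, ∑ p ∈ Nat.primesLE (Nat.sqrt N), (p : ℝ) * (Nat.log p N + 1) ≤
      8 * (Real.log 4 + 1) * N / Real.log N := by
  have ht : Tendsto (fun N : ℕ => √(N : ℝ)) atTop atTop :=
    Real.tendsto_sqrt_atTop.comp tendsto_natCast_atTop_atTop
  filter_upwards [eventually_ge_atTop 16,
    ht.eventually (Chebyshev.eventually_primeCounting_le one_pos)] with N hN hπ
  rw [Real.nat_floor_real_sqrt_eq_nat_sqrt] at hπ
  have hN0 : (16 : ℝ) ≤ N := by exact_mod_cast hN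
  have hyN : √(N : ℝ) ^ 2 = N := Real.sq_sqrt (by linarith)
  have hlog : 0 < Real.log N := Real.log_pos (by linarith)
  have h1 := Finset.sum_le_card_nsmul (Nat.primesLE (Nat.sqrt N))
    (fun p => (p : ℝ) * (Nat.log p N + 1)) (4 * √(N : ℝ)) fun p hp =>
      prime_mul_natLog_add_one_le (Nat.two_le_of_mem_primesLE hp) (Nat.le_of_mem_primesLE hp) hN
  rw [Nat.primesLE_card_eq_primeCounting, nsmul_eq_mul] at h1
  refine h1.trans ?_
  rw [Real.log_sqrt (by linarith)] at hπ
  calc (Nat.primeCounting (Nat.sqrt N) : ℝ) * (4 * √(N : ℝ))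
      ≤ (Real.log 4 + 1) * √(N : ℝ) / (Real.log N / 2) * (4 * √(N : ℝ)) := by gcongr
    _ = 8 * (Real.log 4 + 1) * (√(N : ℝ) ^ 2) / Real.log N := by ring
    _ = _ := by rw [hyN]

/-- The main term of the sum over tuples, as a sum over primes `p ≤ m`. -/
noncomputable def primeMainSum (k m : ℕ) : ℝ :=
  ∑ p ∈ Nat.primesLE m, ∑ j ∈ Finset.Icc 1 k, lcmCoeff k j * invPowMul j p

lemma eventually_abs_sumBLcm_sub_le {k : ℕ} (hk : 1 ≤ k) :
    ∀ᶠ x : ℝ in atTop,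
      |sumBLcm k x - ((⌊x⌋₊ : ℕ) : ℝ) ^ k * primeMainSum k (Nat.sqrt ⌊x⌋₊)| ≤
        8 * (Real.log 4 + 1) * k * ((⌊x⌋₊ : ℕ) : ℝ) ^ k / Real.log (⌊x⌋₊ : ℕ) := by
  filter_upwards [(tendsto_nat_floor_atTop (α := ℝ)).eventually
    eventually_sum_prime_mul_natLog_le] with x hx
  rw [sumBLcm_eq]
  generalize ⌊x⌋₊ = N at *
  rw [primeMainSum, Finset.mul_sum, ← Finset.sum_sub_distrib]
  refine (Finset.abs_sum_le_sum_abs _ _).trans ?_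
  refine (Finset.sum_le_sum fun p hp =>
    abs_prime_term_sub_le (Nat.two_le_of_mem_primesLE hp) k).trans ?_
  rw [← Finset.mul_sum]
  refine (mul_le_mul_of_nonneg_left hx (by positivity)).trans (le_of_eq ?_)
  have : (N : ℝ) ^ k = (N : ℝ) ^ (k - 1) * N := by
    rw [← pow_succ, Nat.sub_add_cancel hk]
  rw [this]
  ring

/-! ### Tails of the prime series and the constant `H_k` -/

lemma sq_log_le {x : ℝ} (hx : 1 ≤ x) : Real.log x ^ 2 ≤ 4 * x := by
  have h := Real.log_le_rpow_div (x := x) (by linarith) (ε := 1 / 2) (by norm_num)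
  rw [← Real.sqrt_eq_rpow] at h
  have h0 := Real.log_nonneg hx
  have h1 := Real.sq_sqrt (by linarith : 0 ≤ x)
  have h2 := Real.sqrt_nonneg x
  nlinarith

lemma summable_of_abs_le_div_sq {g : ℕ → ℝ} {A : ℝ}
    (hg : ∀ p, p.Prime → |g p| ≤ A / (p : ℝ) ^ 2) :
    Summable (fun p : Nat.Primes => g p) :=
  (Nat.Primes.summable_const_div_sq A).of_norm_bounded fun p => hg p p.2

lemma tendsto_sum_primesLE {g : ℕ → ℝ} (hg : Summable (fun p : Nat.Primes => g p)) :
    Tendsto (fun n => ∑ p ∈ Nat.primesLE n, g p) atTop (nhds (∑' p : Nat.Primes, g p)) := by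
  have h : HasSum (fun n : ℕ => if n.Prime then g n else 0) (∑' p : Nat.Primes, g p) := by
    rw [← Nat.Primes.coe_nat_injective.hasSum_iff]
    · exact hg.hasSum.congr_fun fun p => if_pos p.2
    · intro n hn
      exact if_neg fun hn' => hn ⟨⟨n, hn'⟩, rfl⟩
  refine (h.tendsto_sum_nat.comp (tendsto_add_atTop_nat 1)).congr fun n => ?_
  simp only [Function.comp, Nat.primesLE_eq_filter_range, Finset.sum_filter]

/-- Puts series dominated by `1/p^2` within reach of `exists_abs_sub_le_div_log`; it uses `log n log
(n+1) ≤ 4(n+1)` and `log (n+1) - log n ≥ 1/(n+1)`. -/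
lemma one_div_succ_sq_le {n : ℕ} (hn : 2 ≤ n) :
    1 / ((n + 1 : ℕ) : ℝ) ^ 2 ≤ 4 * (1 / Real.log n - 1 / Real.log (n + 1 : ℕ)) := by
  have hn' : (2 : ℝ) ≤ n := by exact_mod_cast hn
  have hv : 0 < Real.log n := Real.log_pos (by linarith)
  have hvu : Real.log n ≤ Real.log (n + 1 : ℕ) :=
    Real.log_le_log (by linarith) (by push_cast; linarith)
  have hu : 0 < Real.log (n + 1 : ℕ) := hv.trans_le hvu
  have hm : (0 : ℝ) < (n + 1 : ℕ) := by positivity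
  have h1 : 1 / ((n + 1 : ℕ) : ℝ) ≤ Real.log (n + 1 : ℕ) - Real.log n := by
    have h := Real.log_le_sub_one_of_pos (x := (n : ℝ) / (n + 1 : ℕ)) (by positivity)
    rw [Real.log_div (by linarith) hm.ne'] at h
    have e : (n : ℝ) / (n + 1 : ℕ) - 1 = -(1 / ((n + 1 : ℕ) : ℝ)) := by
      push_cast
      field_simp
      ring
    linarith
  have h2 : Real.log n * Real.log (n + 1 : ℕ) ≤ 4 * (n + 1 : ℕ) := by
    have := sq_log_le (x := (n + 1 : ℕ)) (by push_cast; linarith)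
    nlinarith
  rw [div_sub_div _ _ hv.ne' hu.ne', one_mul, mul_one, ← mul_div_assoc,
    div_le_div_iff₀ (by positivity) (by positivity), one_mul]
  calc Real.log n * Real.log (n + 1 : ℕ) ≤ 4 * (n + 1 : ℕ) := h2
    _ = 4 * (1 / ((n + 1 : ℕ) : ℝ)) * ((n + 1 : ℕ) : ℝ) ^ 2 := by field_simp
    _ ≤ _ := by gcongr

lemma abs_sum_primesLE_sub_tsum_le {g : ℕ → ℝ} {A : ℝ}
    (hg : ∀ p, p.Prime → |g p| ≤ A / (p : ℝ) ^ 2) {n : ℕ} (hn : 2 ≤ n) :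
    |∑ p ∈ Nat.primesLE n, g p - ∑' p : Nat.Primes, g p| ≤ 4 * A / Real.log n := by
  have hA : 0 ≤ A := by
    have h := (abs_nonneg _).trans (hg 2 Nat.prime_two)
    by_contra hA
    have : A / ((2 : ℕ) : ℝ) ^ 2 < 0 := div_neg_of_neg_of_pos (not_le.1 hA) (by positivity)
    linarith
  have hlim := tendsto_sum_primesLE (summable_of_abs_le_div_sq hg)
  obtain ⟨C, hC⟩ := exists_abs_sub_le_div_log (D := fun n => ∑ p ∈ Nat.primesLE n, g p)
    (K := 4 * A) (by
      intro n hn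
      have h := mul_le_mul_of_nonneg_left (one_div_succ_sq_le hn) hA
      rw [sum_primesLE_succ, add_sub_cancel_left]
      have h2 : |if (n + 1).Prime then g (n + 1) else 0| ≤ A * (1 / ((n + 1 : ℕ) : ℝ) ^ 2) := by
        split_ifs with hp
        · simpa [div_eq_mul_inv] using hg _ hp
        · rw [abs_zero]
          positivity
      refine h2.trans (h.trans (le_of_eq ?_))
      ring)
  have hC' : Tendsto (fun n => ∑ p ∈ Nat.primesLE n, g p) atTop (nhds C) := by
    rw [tendsto_iff_norm_sub_tendsto_zero]
    exact squeeze_zero' (Eventually.of_forall fun _ => norm_nonneg _) (eventually_atTop.2 ⟨2, hC⟩)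
      ((Real.tendsto_log_atTop.comp tendsto_natCast_atTop_atTop).const_div_atTop (4 * A))
  rw [tendsto_nhds_unique hlim hC']
  exact hC n hn

lemma one_div_mul_sub_one_le {p : ℕ} (hp : p.Prime) :
    |1 / ((p : ℝ) * ((p : ℝ) - 1))| ≤ 2 / (p : ℝ) ^ 2 := by
  have hp2 : (2 : ℝ) ≤ p := by exact_mod_cast hp.two_le
  have h : 0 < (p : ℝ) * ((p : ℝ) - 1) := mul_pos (by linarith) (by linarith)
  rw [abs_of_nonneg (by positivity), div_le_div_iff₀ h (by positivity)]
  nlinarith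

lemma abs_invPowMul_le {j : ℕ} (hj : 2 ≤ j) {p : ℕ} (hp : p.Prime) :
    |invPowMul j p| ≤ 2 / (p : ℝ) ^ 2 := by
  have hp2 : (2 : ℝ) ≤ p := by exact_mod_cast hp.two_le
  have h1 : (p : ℝ) ≤ (p : ℝ) ^ (j - 1) := le_self_pow₀ (by linarith) (by omega)
  have h2 : (p : ℝ) ≤ (p : ℝ) ^ j := le_self_pow₀ (by linarith) (by omega)
  have h3 : 0 < (p : ℝ) - 1 := by linarith
  have h4 : 0 < (p : ℝ) ^ j - 1 := by linarith
  refine le_trans ?_ (one_div_mul_sub_one_le hp)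
  rw [invPowMul, abs_of_nonneg (by positivity), abs_of_nonneg (by positivity)]
  gcongr

lemma abs_log_one_sub_add_le {p : ℕ} (hp : p.Prime) :
    |Real.log (1 - 1 / (p : ℝ)) + 1 / (p : ℝ)| ≤ 2 / (p : ℝ) ^ 2 := by
  have hp2 : (2 : ℝ) ≤ p := by exact_mod_cast hp.two_le
  have h := abs_neg_log_one_sub_sub_le (x := 1 / (p : ℝ)) (by positivity)
    (one_div_le_one_div_of_le two_pos hp2)
  rw [← abs_neg]
  calc _ = |-Real.log (1 - 1 / (p : ℝ)) - 1 / (p : ℝ)| := by congr 1; ring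
    _ ≤ _ := h
    _ = _ := by rw [div_pow]; ring

lemma one_div_sub_one_eq {p : ℕ} (hp : p.Prime) :
    1 / ((p : ℝ) - 1) = 1 / (p : ℝ) + 1 / ((p : ℝ) * ((p : ℝ) - 1)) := by
  have hp2 : (2 : ℝ) ≤ p := by exact_mod_cast hp.two_le
  have : (p : ℝ) - 1 ≠ 0 := by linarith
  field_simp
  ring

/-- The first series belongs to the Mertens constant; the second is the cost of replacing `1/p` by
`1/(p-1)`. -/
lemma hasSum_termF : HasSum termF
    (∑' p : Nat.Primes, (Real.log (1 - 1 / ((p : ℕ) : ℝ)) + 1 / ((p : ℕ) : ℝ)) +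
      ∑' p : Nat.Primes, 1 / (((p : ℕ) : ℝ) * (((p : ℕ) : ℝ) - 1))) := by
  refine ((summable_of_abs_le_div_sq (g := fun p => Real.log (1 - 1 / (p : ℝ)) + 1 / (p : ℝ))
    fun p hp => abs_log_one_sub_add_le hp).hasSum.add
    (summable_of_abs_le_div_sq (g := fun p => 1 / ((p : ℝ) * ((p : ℝ) - 1)))
    fun p hp => one_div_mul_sub_one_le hp).hasSum).congr_fun fun p => ?_
  rw [termF, one_div_sub_one_eq p.2]
  ring

lemma summable_termH {j : ℕ} (hj : 2 ≤ j) : Summable (termH j) :=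
  summable_of_abs_le_div_sq (g := invPowMul j) fun _ hp => abs_invPowMul_le hj hp

lemma exists_abs_sum_one_div_sub_one_le :
    ∃ A : ℝ, ∀ m : ℕ, 2 ≤ m →
      |∑ p ∈ Nat.primesLE m, 1 / ((p : ℝ) - 1) - Real.log (Real.log m) - constF| ≤
        A / Real.log m := by
  obtain ⟨C, K, hC⟩ := exists_abs_sum_inv_primes_sub_le
  have hCeq := mertens_constant_eq hC
  refine ⟨K + 4 * 2, fun m hm => ?_⟩
  have h1 := hC m hm
  have h2 := abs_sum_primesLE_sub_tsum_le (g := fun p => 1 / ((p : ℝ) * ((p : ℝ) - 1)))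
    (fun p hp => one_div_mul_sub_one_le hp) hm
  have h3 : ∑ p ∈ Nat.primesLE m, 1 / ((p : ℝ) - 1) =
      ∑ p ∈ Nat.primesLE m, 1 / (p : ℝ) +
        ∑ p ∈ Nat.primesLE m, 1 / ((p : ℝ) * ((p : ℝ) - 1)) := by
    rw [← Finset.sum_add_distrib]
    exact Finset.sum_congr rfl fun p hp => one_div_sub_one_eq (Nat.prime_of_mem_primesLE hp)
  rw [h3, constF, hasSum_termF.tsum_eq, add_div]
  refine le_trans (le_of_eq ?_) ((abs_add_le _ _).trans (add_le_add h1 h2))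
  rw [hCeq]
  congr 1
  ring

lemma exists_abs_primeMainSum_sub_le {k : ℕ} (hk : 1 ≤ k) :
    ∃ A : ℝ, ∀ m : ℕ, 2 ≤ m →
      |primeMainSum k m - (k * Real.log (Real.log m) + constH k)| ≤ A / Real.log m := by
  obtain ⟨A, hA⟩ := exists_abs_sum_one_div_sub_one_le
  refine ⟨k * A + ∑ j ∈ Finset.Icc 2 k, |lcmCoeff k j| * (4 * 2), fun m hm => ?_⟩
  have hW : primeMainSum k m = k * ∑ p ∈ Nat.primesLE m, 1 / ((p : ℝ) - 1) +
      ∑ j ∈ Finset.Icc 2 k, lcmCoeff k j * ∑ p ∈ Nat.primesLE m, invPowMul j p := by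
    -- The index `j = 1` is split off: it alone gives a divergent prime sum.
    rw [primeMainSum, Finset.sum_comm, ← Finset.add_sum_Ioc_eq_sum_Icc hk]
    simp only [← Finset.mul_sum]
    congr 1
    simp [lcmCoeff, invPowMul]
  have hH : constH k = k * constF +
      ∑ j ∈ Finset.Icc 2 k, lcmCoeff k j * ∑' p : Nat.Primes, invPowMul j p := rfl
  have e : primeMainSum k m - (k * Real.log (Real.log m) + constH k) =
      k * (∑ p ∈ Nat.primesLE m, 1 / ((p : ℝ) - 1) - Real.log (Real.log m) - constF) +
      ∑ j ∈ Finset.Icc 2 k, lcmCoeff k j *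
        (∑ p ∈ Nat.primesLE m, invPowMul j p - ∑' p : Nat.Primes, invPowMul j p) := by
    rw [hW, hH]
    simp only [mul_sub, Finset.sum_sub_distrib]
    ring
  rw [e, add_div, Finset.sum_div]
  refine (abs_add_le _ _).trans (add_le_add ?_ ?_)
  · rw [abs_mul, Nat.abs_cast, mul_div_assoc]
    exact mul_le_mul_of_nonneg_left (hA m hm) (Nat.cast_nonneg k)
  · refine (Finset.abs_sum_le_sum_abs _ _).trans (Finset.sum_le_sum fun j hj => ?_)
    rw [abs_mul, mul_div_assoc]
    exact mul_le_mul_of_nonneg_left (abs_sum_primesLE_sub_tsum_le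
      (fun p hp => abs_invPowMul_le (Finset.mem_Icc.1 hj).1 hp) hm) (abs_nonneg _)

/-! ### Passage from integer parts to real `x` -/

lemma natSqrt_floor_bounds {x : ℝ} (hx : 0 ≤ x) :
    (Nat.sqrt ⌊x⌋₊ : ℝ) ≤ √x ∧ √x < Nat.sqrt ⌊x⌋₊ + 1 := by
  constructor
  · refine Real.le_sqrt_of_sq_le ?_
    have h : ((Nat.sqrt ⌊x⌋₊ ^ 2 : ℕ) : ℝ) ≤ ⌊x⌋₊ := by exact_mod_cast Nat.sqrt_le' ⌊x⌋₊
    push_cast at h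
    exact h.trans (Nat.floor_le hx)
  · rw [Real.sqrt_lt' (by positivity)]
    have h : ((⌊x⌋₊ + 1 : ℕ) : ℝ) ≤ ((Nat.sqrt ⌊x⌋₊).succ ^ 2 : ℕ) := by
      exact_mod_cast Nat.lt_succ_sqrt' ⌊x⌋₊
    push_cast at h
    exact (Nat.lt_floor_add_one x).trans_le h

/-- Replacing `√x` by its integer part in `log log` costs `O(1 / log x)`. -/
lemma natSqrt_floor_log_bounds {x : ℝ} (hx : 256 ≤ x) :
    2 ≤ Nat.sqrt ⌊x⌋₊ ∧ Real.log x / 4 ≤ Real.log (Nat.sqrt ⌊x⌋₊) ∧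
      |Real.log (Real.log (Nat.sqrt ⌊x⌋₊)) - Real.log (Real.log √x)| ≤ 4 / Real.log x := by
  obtain ⟨hle, hlt⟩ := natSqrt_floor_bounds (by linarith : 0 ≤ x)
  generalize Nat.sqrt ⌊x⌋₊ = m at *
  have hsq := Real.sq_sqrt (by linarith : 0 ≤ x)
  have h16 : 16 ≤ √x := Real.le_sqrt_of_sq_le (by linarith)
  have hm2 : (2 : ℝ) ≤ m := by linarith
  have hlogx : 0 < Real.log x := Real.log_pos (by linarith)
  have hs4 : 4 ≤ √√x := Real.le_sqrt_of_sq_le (by linarith)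
  have hss := Real.sq_sqrt (Real.sqrt_nonneg x)
  -- The threshold `256 = 4^4` makes `√√x ≥ 4`, and then `m > √x - 1 ≥ √√x`.
  have h1 : √√x ≤ m := by nlinarith
  have h2 : Real.log x / 4 ≤ Real.log m := by
    have h := Real.log_le_log (by linarith) h1
    rw [Real.log_sqrt (Real.sqrt_nonneg x), Real.log_sqrt (by linarith)] at h
    linarith
  refine ⟨by exact_mod_cast hm2, h2, ?_⟩
  have hlm : 0 < Real.log m := by linarith
  have hlms : Real.log m ≤ Real.log √x := Real.log_le_log (by linarith) hle
  have h3 : Real.log √x - Real.log m ≤ 1 := by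
    rw [← Real.log_div (by linarith) (by linarith)]
    refine (Real.log_le_sub_one_of_pos (by positivity)).trans ?_
    rw [sub_le_iff_le_add, div_le_iff₀ (by linarith)]
    linarith
  have h4 : Real.log (Real.log √x) - Real.log (Real.log m) ≤ 1 / Real.log m := by
    rw [← Real.log_div (hlm.trans_le hlms).ne' hlm.ne']
    refine (Real.log_le_sub_one_of_pos (div_pos (hlm.trans_le hlms) hlm)).trans ?_
    rw [sub_le_iff_le_add, div_le_iff₀ hlm, add_mul, div_mul_cancel₀ _ hlm.ne']
    linarith
  have h5 : Real.log (Real.log m) ≤ Real.log (Real.log √x) := Real.log_le_log hlm hlms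
  have h6 : 1 / Real.log m ≤ 4 / Real.log x := by
    rw [div_le_div_iff₀ hlm hlogx]
    linarith
  rw [abs_sub_comm, abs_of_nonneg (by linarith)]
  linarith

lemma pow_sub_floor_pow_bounds {x : ℝ} (hx : 1 ≤ x) {k : ℕ} (hk : 1 ≤ k) :
    |((⌊x⌋₊ : ℕ) : ℝ) ^ k - x ^ k| ≤ k * x ^ k / x := by
  have hle := Nat.floor_le (by linarith : 0 ≤ x)
  have hlt := Nat.lt_floor_add_one x
  have h0 : (0 : ℝ) ≤ (⌊x⌋₊ : ℕ) := Nat.cast_nonneg _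
  refine (abs_pow_sub_pow_le _ _ _).trans ?_
  have h1 : |((⌊x⌋₊ : ℕ) : ℝ) - x| ≤ 1 := by
    rw [abs_le]
    constructor <;> linarith
  have h2 : max |((⌊x⌋₊ : ℕ) : ℝ)| |x| ≤ x := by
    rw [abs_of_nonneg h0, abs_of_nonneg (by linarith)]
    exact max_le hle le_rfl
  have h3 : 0 ≤ max |((⌊x⌋₊ : ℕ) : ℝ)| |x| := (abs_nonneg _).trans (le_max_left _ _)
  calc _ ≤ 1 * (k : ℝ) * x ^ (k - 1) := by gcongr
    _ = k * x ^ k / x := by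
      rw [eq_div_iff (by linarith), mul_assoc, ← pow_succ, Nat.sub_add_cancel hk, one_mul]

theorem theorem9 (k : ℕ) (hk : 2 ≤ k) :
    Summable termF ∧
    (∀ j ∈ Finset.Icc 2 k, Summable (termH j)) ∧
    (fun x : ℝ => sumBLcm k x -
        (k * x ^ k * Real.log (Real.log (Real.sqrt x)) + constH k * x ^ k))
      =O[atTop] (fun x : ℝ => x ^ k / Real.log x) := by
  refine ⟨hasSum_termF.summable, fun j hj => summable_termH (Finset.mem_Icc.1 hj).1, ?_⟩
  have hk1 : 1 ≤ k := by omega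
  obtain ⟨A, hA⟩ := exists_abs_primeMainSum_sub_le hk1
  have hA0 : 0 ≤ A := by
    have h := (abs_nonneg _).trans (hA 2 le_rfl)
    by_contra hneg
    have := div_neg_of_neg_of_pos (not_le.1 hneg) (Real.log_pos (by norm_num : (1 : ℝ) < (2 : ℕ)))
    linarith
  set c := 8 * (Real.log 4 + 1) * k with hc
  have hc0 : 0 ≤ c := by
    have := Real.log_nonneg (by norm_num : (1 : ℝ) ≤ 4)
    positivity
  -- The three summands bound, in order, the per-prime errors, the error in the prime sum, and the
  -- replacement of `⌊x⌋₊ ^ k` by `x ^ k`.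
  refine IsBigO.of_bound (c * 4 + (4 * A + 4 * k) + k * ((k + |constH k|) * 4)) ?_
  filter_upwards [eventually_abs_sumBLcm_sub_le hk1, eventually_ge_atTop 256] with x hS hx
  obtain ⟨hm2, hlogm, hll⟩ := natSqrt_floor_log_bounds hx
  have hpow := pow_sub_floor_pow_bounds (by linarith : 1 ≤ x) hk1
  have hWm := hA _ hm2
  have hlogx : 1 ≤ Real.log x := by
    rw [Real.le_log_iff_exp_le (by linarith)]
    linarith [Real.exp_one_lt_d9]
  have hlog2 : 2 ≤ Real.log x := by
    have h4 : (2 : ℝ) = Real.log (Real.exp 2) := (Real.log_exp 2).symm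
    rw [h4]
    refine Real.log_le_log (Real.exp_pos 2) ?_
    have : Real.exp 2 = Real.exp 1 * Real.exp 1 := by
      rw [← Real.exp_add]
      norm_num
    nlinarith [Real.exp_one_lt_d9, Real.exp_pos 1]
  have hNm : (Nat.sqrt ⌊x⌋₊ : ℝ) ≤ (⌊x⌋₊ : ℕ) := by exact_mod_cast Nat.sqrt_le_self _
  have hNx : ((⌊x⌋₊ : ℕ) : ℝ) ≤ x := Nat.floor_le (by linarith)
  have hm2' : (2 : ℝ) ≤ (Nat.sqrt ⌊x⌋₊ : ℝ) := by exact_mod_cast hm2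
  have hlogN : Real.log x / 4 ≤ Real.log (⌊x⌋₊ : ℕ) :=
    hlogm.trans (Real.log_le_log (by linarith) hNm)
  set W := primeMainSum k (Nat.sqrt ⌊x⌋₊)
  set lm := Real.log (Nat.sqrt ⌊x⌋₊ : ℕ)
  set N : ℝ := ((⌊x⌋₊ : ℕ) : ℝ)
  set V := k * Real.log (Real.log √x) + constH k with hV
  have hl0 : 0 < Real.log x := by linarith
  have hN0 : 0 ≤ N := Nat.cast_nonneg _
  have hNk : N ^ k ≤ x ^ k := by gcongr
  have hxk : 0 < x ^ k := by positivity
  have e1 : |sumBLcm k x - N ^ k * W| ≤ c * 4 * (x ^ k / Real.log x) := by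
    refine hS.trans ?_
    calc c * N ^ k / Real.log N ≤ c * x ^ k / (Real.log x / 4) := by gcongr
      _ = _ := by field_simp
  have e2 : |W - V| ≤ (4 * A + 4 * k) / Real.log x := by
    have h1 : |W - (k * Real.log lm + constH k)| ≤ 4 * A / Real.log x := by
      refine hWm.trans ?_
      calc A / lm ≤ A / (Real.log x / 4) := by gcongr
        _ = _ := by field_simp
    have h2 : |k * (Real.log lm - Real.log (Real.log √x))| ≤ 4 * k / Real.log x := by
      rw [abs_mul, Nat.abs_cast]
      refine (mul_le_mul_of_nonneg_left hll (Nat.cast_nonneg k)).trans (le_of_eq ?_)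
      ring
    rw [add_div]
    refine le_trans (le_of_eq ?_) ((abs_add_le _ _).trans (add_le_add h1 h2))
    congr 1
    rw [hV]
    ring
  have e3 : |V| ≤ (k + |constH k|) * Real.log x := by
    have hls : Real.log √x = Real.log x / 2 := Real.log_sqrt (by linarith)
    have h1 : 0 ≤ Real.log (Real.log √x) := Real.log_nonneg (by linarith)
    have h2 : Real.log (Real.log √x) ≤ Real.log x := by
      have := Real.log_le_sub_one_of_pos (x := Real.log √x) (by linarith)
      linarith
    have h3 : |k * Real.log (Real.log √x)| ≤ k * Real.log x := by
      rw [abs_of_nonneg (by positivity)]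
      gcongr
    have h4 : |constH k| ≤ |constH k| * Real.log x :=
      le_mul_of_one_le_right (abs_nonneg _) hlogx
    rw [add_mul]
    exact (abs_add_le _ _).trans (add_le_add h3 h4)
  have e4 : |N ^ k - x ^ k| * |V| ≤
      k * ((k + |constH k|) * 4) * (x ^ k / Real.log x) := by
    -- A crude bound `V ≪ log x` suffices, as the floor saves a full factor `x`.
    have hsq : Real.log x / x ≤ 4 / Real.log x := by
      rw [div_le_div_iff₀ (by linarith) hl0]
      have := sq_log_le (by linarith : 1 ≤ x)
      nlinarith
    calc |N ^ k - x ^ k| * |V| ≤ k * x ^ k / x * ((k + |constH k|) * Real.log x) := by gcongr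
      _ = k * x ^ k * (k + |constH k|) * (Real.log x / x) := by ring
      _ ≤ k * x ^ k * (k + |constH k|) * (4 / Real.log x) := by gcongr
      _ = _ := by ring
  have e5 : |N ^ k * (W - V)| ≤ (4 * A + 4 * k) * (x ^ k / Real.log x) := by
    rw [abs_mul, abs_of_nonneg (by positivity)]
    calc N ^ k * |W - V| ≤ x ^ k * ((4 * A + 4 * k) / Real.log x) := by gcongr
      _ = _ := by ring
  rw [Real.norm_eq_abs, Real.norm_eq_abs, abs_of_nonneg (by positivity : 0 ≤ x ^ k / Real.log x)]
  have e : sumBLcm k x - (k * x ^ k * Real.log (Real.log √x) + constH k * x ^ k) =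
      (sumBLcm k x - N ^ k * W) + N ^ k * (W - V) + (N ^ k - x ^ k) * V := by
    rw [hV]
    ring
  rw [e, add_mul, add_mul]
  refine (abs_add_three _ _ _).trans ?_
  rw [abs_mul (N ^ k - x ^ k)]
  linarith
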